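/- Let $D=(V,A)$ be a finite loopless digraph that is semicomplete, i.e. for any two distinct vertices $x,y$ at least one of $xy,yx$ is an arc. Let $Z_D=\{(x,y): xy\in A \text{ or } yx\in A\}$. For $(x,y),(x',y')\in Z_D$ write $(x,y)\,\Gamma\,(x',y')$ if one of the following holds: - $x=x'$ and $y=y'$; - $x=x'$, $y\ne y'$, and either $yx,x'y'\in A$ and $yy'\notin A$, or $y'x',xy\in A$ and $y'y\notin A$; - $y=y'$, $x\neq x'$, and either $xy,y'x'\in A$ and $xx'\notin A$, or $x'y',yx\in A$ and $x'x\notin A$. The equivalence classes of $Z_D$ under the transitive closure of $\Gamma$ are the implication classes of $D$; their set is $\mathcal I(D)$. For $I\subseteq Z_D$ put $I^{-1}=\{(y,x):(x,y)\in I\}$. A comparability ordering of $D$ is a strict linear order $\prec$ on $V$ such that for all $x\prec y\prec z$: if $xy,yz\in A$ then $xz\in A$, and if $zy,yx\in A$ then $zx\in A$. $D$ is a comparability digraph if it has a comparability ordering. Consider the following nondeterministic algorithm. 1. If $I=I^{-1}$ for some $I\in\mathcal I(D)$, halt with the answer "$D$ is not a comparability digraph". 2. Otherwise set $T=\emptyset$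 and $\mathcal C=\{I\in\mathcal I(D): |I|>1\}$. 3. While $\mathcal C\ne\emptyset$: if there are $(x,y),(y,z)\in T$ and $I\in\mathcal C$ with $(x,z)\in I$, choose any such $I$; otherwise choose an arbitrary $I\in\mathcal C$. Replace $T$ by $T\cup I$ and $\mathcal C$ by $\mathcal C\setminus\{I,I^{-1}\}$. 4. Return any strict linear order $\prec$ on $V$ such that $x\prec y$ for all $(x,y)\in T$. **Theorem.** Suppose that $I\ne I^{-1}$ for every $I\in\mathcal I(D)$. Then, whatever choices are made, the algorithm terminates (it has no infinite run), every run can be carried out to the end (in particular a linear order as required in step 4 exists), and every run returns a comparability ordering of $D$. Consequently $D$ is a comparability digraph. -/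

import Mathlib

namespace ComparabilityDigraph

variable {V : Type*}

/-- `D` is semicomplete: it has no loops, and any two distinct vertices are joined
by an arc in at least one direction (possibly both). -/
structure IsSemicomplete (D : Digraph V) : Prop where
  loopless : ∀ x, ¬ D.Adj x x
  total : ∀ x y, x ≠ y → D.Adj x y ∨ D.Adj y x

/-- The strict linear order `lt` of the vertices is a comparability ordering of `D`. -/
structure IsComparabilityOrdering (D : Digraph V) (lt : V → V → Prop) : Prop where
  ordering : IsStrictTotalOrder V lt
  forward : ∀ x y z, lt x y → lt y z → D.Adj x y → D.Adj y z → D.Adj x z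
  backward : ∀ x y z, lt x y → lt y z → D.Adj z y → D.Adj y x → D.Adj z x

/-- `D` is a comparability digraph. -/
def IsComparabilityDigraph (D : Digraph V) : Prop :=
  ∃ lt : V → V → Prop, IsComparabilityOrdering D lt

/-- `Z_D`: the ordered pairs of adjacent vertices of `D`. -/
def pairs (D : Digraph V) : Set (V × V) :=
  {p | D.Adj p.1 p.2 ∨ D.Adj p.2 p.1}

/-- The relation `Γ` on `Z_D`: the pair `p = (x, y)` directly forces the pair
`q = (x', y')`. -/
def DirectlyForces (D : Digraph V) (p q : V × V) : Prop :=
  p ∈ pairs D ∧ q ∈ pairs D ∧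
    ((p.1 = q.1 ∧ p.2 = q.2) ∨
     (p.1 = q.1 ∧ p.2 ≠ q.2 ∧
        ((D.Adj p.2 p.1 ∧ D.Adj q.1 q.2 ∧ ¬ D.Adj p.2 q.2) ∨
         (D.Adj q.2 q.1 ∧ D.Adj p.1 p.2 ∧ ¬ D.Adj q.2 p.2))) ∨
     (p.2 = q.2 ∧ p.1 ≠ q.1 ∧
        ((D.Adj p.1 p.2 ∧ D.Adj q.2 q.1 ∧ ¬ D.Adj p.1 q.1) ∨
         (D.Adj q.1 q.2 ∧ D.Adj p.2 p.1 ∧ ¬ D.Adj q.1 p.1))))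

/-- The set of implication classes of `D`: the equivalence classes of `Z_D` under the
transitive closure of `Γ`. -/
def implicationClasses (D : Digraph V) : Set (Set (V × V)) :=
  {I | ∃ p ∈ pairs D, I = {q | Relation.TransGen (DirectlyForces D) p q}}

/-- The inverse `{(y, x) | (x, y) ∈ I}` of a set of pairs. -/
def inverse (I : Set (V × V)) : Set (V × V) :=
  {p | (p.2, p.1) ∈ I}

/-- `I` contains a pair `(x, z)` such that `(x, y)` and `(y, z)` are in `T` for some `y`. -/
def ForcedBy (T I : Set (V × V)) : Prop :=
  ∃ x y z, (x, y) ∈ T ∧ (y, z) ∈ T ∧ (x, z) ∈ I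

/-- The states of the algorithm. -/
inductive State (V : Type*) where
  /-- before anything has been done -/
  | start
  /-- at the head of the while loop, with the current set `T` of pairs and the current
  set `C` of implication classes that are still to be treated -/
  | loop (T : Set (V × V)) (C : Set (Set (V × V)))
  /-- halted with the answer that the input is not a comparability digraph -/
  | rejected
  /-- halted with the vertex ordering `lt` as output -/
  | returned (lt : V → V → Prop)

/-- One step of the (nondeterministic) algorithm on input `D`. -/
inductive Step (D : Digraph V) : State V → State V → Prop
  /-- some implication class equals its inverse: reject -/
  | reject (h : ∃ I ∈ implicationClasses D, I = inverse I) :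
      Step D .start .rejected
  /-- otherwise start with `T = ∅` and all the implication classes with more than
  one element -/
  | init (h : ¬ ∃ I ∈ implicationClasses D, I = inverse I) :
      Step D .start (.loop ∅ {I | I ∈ implicationClasses D ∧ I.Nontrivial})
  /-- a class with a pair implied by the transitivity of `T` has priority -/
  | forced (T : Set (V × V)) (C : Set (Set (V × V))) (I : Set (V × V))
      (hI : I ∈ C) (h : ForcedBy T I) :
      Step D (.loop T C) (.loop (T ∪ I) (C \ {I, inverse I}))
  /-- if there is none, an arbitrary remaining class is chosen -/
  | free (T : Set (V × V)) (C : Set (Set (V × V))) (I : Set (V × V))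
      (hI : I ∈ C) (h : ¬ ∃ J ∈ C, ForcedBy T J) :
      Step D (.loop T C) (.loop (T ∪ I) (C \ {I, inverse I}))
  /-- when no class is left, return any vertex ordering that extends `T` -/
  | finish (T : Set (V × V)) (lt : V → V → Prop) (hlt : IsStrictTotalOrder V lt)
      (h : ∀ x y, (x, y) ∈ T → lt x y) :
      Step D (.loop T ∅) (.returned lt)

end ComparabilityDigraph

/-!
Write `[xy]` for the class of `(x, y)`. The argument adapts the Gallai–Golumbic theory of
transitive orientations to pairs that are *proper*: joined by two arcs or with a nontrivial class.

* For proper `(a, b)` and `(a, c)` with `[bc] ≠ [ac]` and `[bc] ≠ [ba]`, the classes `[ab']` and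
  `[ac']` do not depend on the choice of `(b', c')` in `[bc]`.
* If `(x, y)` and `(y, z)` are proper, `(x, z)` is not and `[yx] ≠ [yz]`, then `[xy] = [yz]`.

Consequently an asymmetric union of classes that is transitive on proper pairs remains so when an
undecided class is added together with the classes that are then implied by transitivity. By Zorn's
lemma it extends to such a union `T` that orients all proper pairs. All chords of a shortest cycle
of `T` are improper arcs. Since improper arcs form a transitive relation while the chords of a cycle
of length at least five have no transitive orientation, and shorter cycles are excluded directly,
`T` is acyclic. Every linear extension of `T` is a comparability ordering, because `xy, yz ∈ A` and
`xz ∉ A` make `(x, y)` and `(z, y)` equivalent.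

The relation built by the algorithm always extends to such a `T`. For a forced class this is clear,
by transitivity of `T`. When no class is forced, the current relation becomes transitive on proper
pairs by adding only pairs joined by two arcs whose class is trivial. This decides none of the
remaining classes, so that any of them may be added.
-/

namespace ComparabilityDigraph

open Relation (TransGen ReflTransGen ReflGen)

variable {V : Type*} {D : Digraph V} {x y z x' y' : V}

/-- The implication class of the pair `(x, y)`; it is empty if `x` and `y` are not adjacent. -/
def classOf (D : Digraph V) (x y : V) : Set (V × V) :=
  {q | TransGen (DirectlyForces D) (x, y) q}

/-- Both `xy` and `yx` are arcs. -/
def Double (D : Digraph V) (x y : V) : Prop := D.Adj x y ∧ D.Adj y x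

/-- Of `xy` and `yx` only `xy` is an arc. -/
def Single (D : Digraph V) (x y : V) : Prop := D.Adj x y ∧ ¬ D.Adj y x

/-- The pair `(x, y)` is joined by two arcs or has a nontrivial implication class. These are the
pairs whose order is restricted by the triangle lemma. -/
def Proper (D : Digraph V) (x y : V) : Prop := (classOf D x y).Nontrivial ∨ Double D x y

/-- The arc `xz` is not proper: it is a single arc, and `{(x, z)}` is an implication class. -/
def Improper (D : Digraph V) (x z : V) : Prop := Single D x z ∧ ¬ (classOf D x z).Nontrivial

/-- A semicomplete digraph in which no implication class is its own inverse. -/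
structure IsConsistent (D : Digraph V) : Prop extends IsSemicomplete D where
  classOf_ne : ∀ x y, x ≠ y → classOf D x y ≠ classOf D y x

/-- The digraph obtained from `D` by reversing all arcs. -/
def rev (D : Digraph V) : Digraph V where
  Adj x y := D.Adj y x

theorem Double.symm (h : Double D x y) : Double D y x := ⟨h.2, h.1⟩

section Classes

theorem DirectlyForces.symm {p q : V × V} (h : DirectlyForces D p q) : DirectlyForces D q p := by
  obtain ⟨hp, hq, ⟨h₁, h₂⟩ | ⟨h₁, h₂, h⟩ | ⟨h₁, h₂, h⟩⟩ := h
  · exact ⟨hq, hp, .inl ⟨h₁.symm, h₂.symm⟩⟩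
  · rw [h₁] at h
    exact ⟨hq, hp, .inr <| .inl ⟨h₁.symm, h₂.symm, h₁ ▸ h.symm⟩⟩
  · rw [h₁] at h
    exact ⟨hq, hp, .inr <| .inr ⟨h₁.symm, h₂.symm, h₁ ▸ h.symm⟩⟩

theorem DirectlyForces.swap {p q : V × V} (h : DirectlyForces D p q) :
    DirectlyForces D p.swap q.swap := by
  obtain ⟨hp, hq, ⟨h₁, h₂⟩ | ⟨h₁, h₂, h⟩ | ⟨h₁, h₂, h⟩⟩ := h
  · exact ⟨hp.symm, hq.symm, .inl ⟨h₂, h₁⟩⟩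
  · exact ⟨hp.symm, hq.symm, .inr <| .inr ⟨h₁, h₂, h⟩⟩
  · exact ⟨hp.symm, hq.symm, .inr <| .inl ⟨h₁, h₂, h⟩⟩

theorem DirectlyForces.fst_eq_or_snd_eq {p q : V × V} (h : DirectlyForces D p q) :
    p.1 = q.1 ∨ p.2 = q.2 := by
  obtain ⟨-, -, h | h | h⟩ := h
  exacts [.inl h.1, .inl h.1, .inr h.1]

theorem DirectlyForces.cases_left (h : DirectlyForces D (x, y) (x, z)) (hyz : y ≠ z) :
    (D.Adj y x ∧ D.Adj x z ∧ ¬ D.Adj y z) ∨ (D.Adj z x ∧ D.Adj x y ∧ ¬ D.Adj z y) := by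
  obtain ⟨-, -, h | h | h⟩ := h
  exacts [absurd h.2 hyz, h.2.2, absurd rfl h.2.1]

theorem transGen_directlyForces_symm {p q : V × V} (h : TransGen (DirectlyForces D) p q) :
    TransGen (DirectlyForces D) q p := by
  rw [← Relation.transGen_swap]
  exact TransGen.mono (fun _ _ => DirectlyForces.symm) _ _ h

theorem mem_classOf_swap {q : V × V} (h : q ∈ classOf D x y) : q.swap ∈ classOf D y x :=
  TransGen.lift Prod.swap (fun _ _ => DirectlyForces.swap) _ _ h

theorem classOf_swap (x y : V) : classOf D y x = inverse (classOf D x y) :=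
  Set.ext fun _ => ⟨mem_classOf_swap, mem_classOf_swap⟩

theorem classOf_eq_of_mem (h : (x', y') ∈ classOf D x y) : classOf D x' y' = classOf D x y :=
  Set.ext fun _ => ⟨fun hq => h.trans hq, fun hq => (transGen_directlyForces_symm h).trans hq⟩

theorem classOf_swap_eq (h : classOf D x y = classOf D x' y') :
    classOf D y x = classOf D y' x' := by
  rw [classOf_swap x y, classOf_swap x' y', h]

theorem mem_classOf_self (h : (x, y) ∈ pairs D) : (x, y) ∈ classOf D x y :=
  .single ⟨h, h, .inl ⟨rfl, rfl⟩⟩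

theorem mem_pairs_of_mem_classOf {q : V × V} (h : q ∈ classOf D x y) : q ∈ pairs D := by
  obtain ⟨_, -, h⟩ := TransGen.tail'_iff.1 h
  exact h.2.1

theorem mem_classOf_of_eq (h : classOf D x' y' = classOf D x y) (hxy : (x, y) ∈ pairs D) :
    (x', y') ∈ classOf D x y :=
  transGen_directlyForces_symm (h.superset (mem_classOf_self hxy))

theorem nontrivial_classOf_of_eq (h : classOf D x' y' = classOf D x y) (hxy : (x, y) ∈ pairs D)
    (hne : (x', y') ≠ (x, y)) : (classOf D x y).Nontrivial :=
  ⟨_, mem_classOf_of_eq h hxy, _, mem_classOf_self hxy, hne⟩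

theorem nontrivial_classOf_symm (h : (classOf D x y).Nontrivial) :
    (classOf D y x).Nontrivial := by
  obtain ⟨p, hp, q, hq, hne⟩ := h
  exact ⟨_, mem_classOf_swap hp, _, mem_classOf_swap hq, Prod.swap_injective.ne hne⟩

theorem Proper.symm (h : Proper D x y) : Proper D y x :=
  h.imp nontrivial_classOf_symm Double.symm

theorem Proper.congr (h : Proper D x y) (e : classOf D x' y' = classOf D x y) :
    Proper D x' y' := by
  by_cases hne : (x', y') = (x, y)
  · obtain ⟨rfl, rfl⟩ := Prod.mk.inj hne
    exact h
  · refine .inl ?_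
    rw [e]
    exact h.elim id fun h => nontrivial_classOf_of_eq e (.inl h.1) hne

theorem classOf_eq_of_path (hxy : D.Adj x y) (hyz : D.Adj y z) (hxz : ¬ D.Adj x z) :
    classOf D y x = classOf D y z := by
  by_cases hne : x = z
  · rw [hne]
  · exact (classOf_eq_of_mem <| .single
      ⟨.inr hxy, .inl hyz, .inr <| .inl ⟨rfl, hne, .inl ⟨hxy, hyz, hxz⟩⟩⟩).symm

theorem Single.classOf_left (hxy : Single D x y) (hyz : Single D y z) (hxz : Double D x z) :
    classOf D x y = classOf D x z :=
  (classOf_eq_of_path hxz.2 hxy.1 hyz.2).symm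

theorem Single.classOf_right (hxy : Single D x y) (hyz : Single D y z) (hxz : Double D x z) :
    classOf D y z = classOf D x z :=
  classOf_swap_eq (classOf_eq_of_path hyz.1 hxz.2 hxy.2)

theorem directlyForces_rev : DirectlyForces (rev D) = DirectlyForces D := by
  ext p q
  simp only [DirectlyForces, pairs, rev, Set.mem_ofPred_eq]
  tauto

theorem classOf_rev (x y : V) : classOf (rev D) x y = classOf D x y := by
  simp only [classOf, directlyForces_rev]

theorem proper_rev : Proper (rev D) x y ↔ Proper D x y := by
  rw [Proper, Proper, classOf_rev]
  exact or_congr_right and_comm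

theorem improper_rev : Improper (rev D) x z ↔ Improper D z x := by
  rw [Improper, Improper, classOf_rev]
  exact and_congr_right fun _ => not_congr ⟨nontrivial_classOf_symm, nontrivial_classOf_symm⟩

end Classes

namespace IsSemicomplete

theorem ne_of_adj (hD : IsSemicomplete D) (h : D.Adj x y) : x ≠ y := by
  rintro rfl
  exact hD.loopless _ h

theorem mem_pairs (hD : IsSemicomplete D) : (x, y) ∈ pairs D ↔ x ≠ y :=
  ⟨fun h => h.elim hD.ne_of_adj fun h => (hD.ne_of_adj h).symm, hD.total x y⟩

theorem single_of_not_adj (hD : IsSemicomplete D) (hne : x ≠ y) (h : ¬ D.Adj x y) :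
    Single D y x :=
  ⟨(hD.total x y hne).resolve_left h, h⟩

theorem ne_of_mem_classOf (hD : IsSemicomplete D) (h : (x', y') ∈ classOf D x y) : x' ≠ y' :=
  hD.mem_pairs.1 (mem_pairs_of_mem_classOf h)

theorem ne_of_classOf_eq (hD : IsSemicomplete D) (h : classOf D x' y' = classOf D x y)
    (hne : x ≠ y) : x' ≠ y' :=
  hD.ne_of_mem_classOf (mem_classOf_of_eq h (hD.mem_pairs.2 hne))

theorem eq_of_not_nontrivial (hD : IsSemicomplete D) (h : ¬ (classOf D x y).Nontrivial)
    (hne : x ≠ y) (e : classOf D x' y' = classOf D x y) : x' = x ∧ y' = y :=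
  Prod.mk.inj <| by_contra fun hxy => h (nontrivial_classOf_of_eq e (hD.mem_pairs.2 hne) hxy)

theorem ne_of_nontrivial (hD : IsSemicomplete D) (h : (classOf D x y).Nontrivial) : x ≠ y := by
  obtain ⟨⟨x', y'⟩, h⟩ := h.nonempty
  exact hD.ne_of_classOf_eq (classOf_eq_of_mem h).symm (hD.ne_of_mem_classOf h)

theorem ne_of_proper (hD : IsSemicomplete D) (h : Proper D x y) : x ≠ y :=
  h.elim hD.ne_of_nontrivial fun h => hD.ne_of_adj h.1

end IsSemicomplete

theorem exists_ne_of_transGen {α : Type*} {r : α → α → Prop} {a b : α} (h : TransGen r a b)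
    (hne : b ≠ a) : ∃ c, c ≠ a ∧ r a c := by
  induction h using TransGen.head_induction_on with
  | single h => exact ⟨_, hne, h⟩
  | @head a c h _ ih =>
    obtain rfl | hc := eq_or_ne c a
    · exact ih hne
    · exact ⟨_, hc, h⟩

namespace IsConsistent

theorem rev (hD : IsConsistent D) : IsConsistent (rev D) where
  loopless := hD.loopless
  total x y h := hD.total y x h.symm
  classOf_ne x y h := by
    rw [classOf_rev, classOf_rev]
    exact hD.classOf_ne x y h

/-- If `xz` were not an arc, going round the cycle of single arcs would put `(x, y)` and `(y, x)`
in the same class. -/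
theorem double_of_path (hD : IsConsistent D) (hxy : Single D x y) (hyz : Single D y z)
    (hzx : D.Adj z x) : Double D x z := by
  by_contra! hxz
  have hxz : ¬ D.Adj x z := fun h => hxz ⟨h, hzx⟩
  have ey := classOf_eq_of_path hxy.1 hyz.1 hxz
  have ez := classOf_eq_of_path hyz.1 hzx hxy.2
  have ex := classOf_eq_of_path hzx hxy.1 hyz.2
  exact hD.classOf_ne x y (hD.ne_of_adj hxy.1) <|
    ex.symm.trans ((classOf_swap_eq ez).symm.trans ey.symm)

theorem exists_detour (hD : IsConsistent D) {a b : V} (hs : Single D a b)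
    (h : (classOf D a b).Nontrivial) :
    (∃ w, Single D b w ∧ Double D a w) ∨ ∃ w, Single D w a ∧ Double D w b := by
  obtain ⟨p, hp, hne⟩ := h.exists_ne (a, b)
  obtain ⟨⟨c, d⟩, hr, hcd⟩ := exists_ne_of_transGen hp hne
  rcases hcd.fst_eq_or_snd_eq with rfl | rfl
  · have hbd : b ≠ d := fun h => hr (h ▸ rfl)
    rcases hcd.cases_left hbd with ⟨hba, -⟩ | ⟨hda, -, hdb⟩
    · exact absurd hba hs.2
    · have sbd := hD.single_of_not_adj hbd.symm hdb
      exact .inl ⟨d, sbd, hD.double_of_path hs sbd hda⟩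
  · have hac : a ≠ c := fun h => hr (h ▸ rfl)
    rcases hcd.swap.cases_left hac with ⟨-, hbc, hac'⟩ | ⟨-, hba, -⟩
    · have sca := hD.single_of_not_adj hac hac'
      exact .inr ⟨c, sca, hD.double_of_path sca hs hbc⟩
    · exact absurd hba hs.2

end IsConsistent

section Triangle

variable {a b c d w : V}

namespace IsConsistent

theorem classOf_eq_left_or_right (hD : IsConsistent D) (sab : Single D a b) (sbc : Single D b c)
    (hac : D.Adj a c) (pac : Proper D a c) :
    classOf D a c = classOf D a b ∨ classOf D a c = classOf D b c := by
  by_cases hca : D.Adj c a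
  · exact .inl (sab.classOf_left sbc ⟨hac, hca⟩).symm
  have sac : Single D a c := ⟨hac, hca⟩
  have nac : (classOf D a c).Nontrivial := pac.resolve_right fun h => hca h.2
  rcases hD.exists_detour sac nac with ⟨v, scv, dav⟩ | ⟨v, sva, dvc⟩
  · have hac_av := sac.classOf_left scv dav
    by_cases hvb : D.Adj v b
    · right
      have dbv := hD.double_of_path sbc scv hvb
      rw [hac_av, ← sac.classOf_right scv dav, sbc.classOf_right scv dbv,
        sbc.classOf_left scv dbv]
    · left
      have hne : v ≠ b := fun h => scv.2 (h ▸ sbc.1)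
      rw [hac_av, sab.classOf_left (hD.single_of_not_adj hne hvb) dav]
  · have hac_vc := sva.classOf_right sac dvc
    by_cases hbv : D.Adj b v
    · left
      have dvb := hD.double_of_path sva sab hbv
      rw [hac_vc, ← sva.classOf_left sac dvc, sva.classOf_left sab dvb,
        sva.classOf_right sab dvb]
    · right
      have hne : b ≠ v := fun h => sva.2 (h ▸ sab.1)
      rw [hac_vc, (hD.single_of_not_adj hne hbv).classOf_right sbc dvc]

theorem classOf_eq_of_chain (hD : IsConsistent D) (sab : Single D a b) (sbw : Single D b w)
    (swc : Single D w c) (daw : Double D a w) (dbc : Double D b c) (sac : Single D a c)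
    (nac : (classOf D a c).Nontrivial) : classOf D b c = classOf D a c := by
  have hab_aw := sab.classOf_left sbw daw
  have hbc_bw := (sbw.classOf_left swc dbc).symm
  have hwc_bc := sbw.classOf_right swc dbc
  have hbw_aw := sab.classOf_right sbw daw
  rcases hD.exists_detour sac nac with ⟨v, scv, dav⟩ | ⟨v, sva, dvc⟩
  · have hac_av := sac.classOf_left scv dav
    by_cases hvw : D.Adj v w
    · have dwv := hD.double_of_path swc scv hvw
      rw [← hwc_bc, swc.classOf_left scv dwv, ← swc.classOf_right scv dwv, hac_av,
        sac.classOf_right scv dav]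
    · rw [hbc_bw, hbw_aw, hac_av, classOf_eq_of_path dav.2 daw.1 hvw]
  · have hac_vc := sva.classOf_right sac dvc
    by_cases hbv : D.Adj b v
    · have dvb := hD.double_of_path sva sab hbv
      rw [hbc_bw, hbw_aw, ← hab_aw, sva.classOf_right sab dvb, ← sva.classOf_left sab dvb,
        sva.classOf_left sac dvc, hac_vc]
    · rw [hac_vc, classOf_swap_eq (classOf_eq_of_path dbc.1 dvc.2 hbv)]

end IsConsistent

/-- The configuration in the forcing step of the triangle lemma: the pair `(b, c)` forces `(b, d)`,
its class is not that of `(b, a)`, and all single arcs at `a` leave `a`. -/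
structure Fan (D : Digraph V) (a b c d : V) : Prop where
  adj_cb : D.Adj c b
  adj_bd : D.Adj b d
  single_dc : Single D d c
  single_ab : Single D a b
  single_ac : Single D a c
  adj_ad : D.Adj a d
  classOf_ne : classOf D b c ≠ classOf D b a

namespace Fan

theorem classOf_bc (F : Fan D a b c d) : classOf D b c = classOf D b d :=
  classOf_eq_of_path F.adj_cb F.adj_bd F.single_dc.2

theorem classOf_of_single_left (F : Fan D a b c d) (swa : Single D w a)
    (dwb : Double D w b) :
    classOf D a d = classOf D a c ∨
      (classOf D b c = classOf D a c ∧ classOf D a b = classOf D a c ∧ ¬ D.Adj d b) := by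
  have hbw_ba := classOf_swap_eq (swa.classOf_right F.single_ab dwb).symm
  have hwa_ab : classOf D w a = classOf D a b :=
    (swa.classOf_left F.single_ab dwb).trans (swa.classOf_right F.single_ab dwb).symm
  have hwd : D.Adj w d := by
    by_contra h
    exact F.classOf_ne (F.classOf_bc.trans <|
      (classOf_eq_of_path dwb.1 F.adj_bd h).symm.trans hbw_ba)
  have hcw : D.Adj c w := by
    by_contra h
    exact F.classOf_ne ((classOf_eq_of_path F.adj_cb dwb.2 h).trans hbw_ba)
  have hwc_wd := classOf_eq_of_path hcw hwd F.single_dc.2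
  have hwc_wa := classOf_eq_of_path hcw swa.1 F.single_ac.2
  have hac_wc := classOf_swap_eq (classOf_eq_of_path F.single_ac.1 hcw swa.2)
  by_cases hdw : D.Adj d w
  · left
    rw [classOf_swap_eq (classOf_eq_of_path F.adj_ad hdw swa.2), ← hwc_wd, hac_wc]
  · right
    have hdb : ¬ D.Adj d b := fun hdb => F.classOf_ne <| F.classOf_bc.trans <|
      (classOf_eq_of_path hdb dwb.2 hdw).trans hbw_ba
    have hcd_cb := classOf_eq_of_path F.single_dc.1 F.adj_cb hdb
    have hcd_cw := classOf_eq_of_path F.single_dc.1 hcw hdw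
    have hbc_wc := classOf_swap_eq (hcd_cb.symm.trans hcd_cw)
    exact ⟨by rw [hbc_wc, hac_wc], by rw [hac_wc, hwc_wa, hwa_ab], hdb⟩

theorem classOf_of_single_right (F : Fan D a b c d) (hD : IsConsistent D) (sbw : Single D b w)
    (daw : Double D a w) (hcw : D.Adj c w) :
    classOf D a d = classOf D a c ∨
      (classOf D b c = classOf D a c ∧ classOf D a b = classOf D a c ∧ ¬ D.Adj d b) := by
  have hab_aw := F.single_ab.classOf_left sbw daw
  have hwc : ¬ D.Adj w c := fun hwc => F.classOf_ne <| by
    rw [classOf_swap_eq (classOf_eq_of_path hwc F.adj_cb sbw.2).symm,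
      classOf_eq_of_path hcw daw.2 F.single_ac.2, classOf_swap_eq hab_aw]
  have scw : Single D c w := ⟨hcw, hwc⟩
  have hac_aw := F.single_ac.classOf_left scw daw
  by_cases hwd : D.Adj w d
  · right
    have ddw := hD.double_of_path F.single_dc scw hwd
    have hcw_dw := F.single_dc.classOf_right scw ddw
    have hcw_aw := F.single_ac.classOf_right scw daw
    have hdb : ¬ D.Adj d b := fun hdb => F.classOf_ne <| classOf_swap_eq <| by
      rw [classOf_swap_eq F.classOf_bc, ← classOf_eq_of_path hwd hdb sbw.2, ← hcw_dw, hcw_aw,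
        hab_aw]
    have hcd_cb := classOf_eq_of_path F.single_dc.1 F.adj_cb hdb
    exact ⟨by rw [← classOf_swap_eq hcd_cb, F.single_dc.classOf_left scw ddw, ← hcw_dw, hcw_aw,
      hac_aw], by rw [hab_aw, hac_aw], hdb⟩
  · left
    rw [hac_aw, classOf_eq_of_path daw.2 F.adj_ad hwd]

theorem classOf_eq_or_exists_chain (F : Fan D a b c d) (hD : IsConsistent D)
    (nab : (classOf D a b).Nontrivial) :
    (classOf D a d = classOf D a c ∨
      (classOf D b c = classOf D a c ∧ classOf D a b = classOf D a c ∧ ¬ D.Adj d b)) ∨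
    ∃ w, Single D b w ∧ Single D w c ∧ Double D a w ∧ Double D b c := by
  rcases hD.exists_detour F.single_ab nab with ⟨w, sbw, daw⟩ | ⟨w, swa, dwb⟩
  · by_cases hcw : D.Adj c w
    · exact .inl (F.classOf_of_single_right hD sbw daw hcw)
    · have hne : c ≠ w := fun h => F.single_ac.2 (h ▸ daw.2)
      have swc := hD.single_of_not_adj hne hcw
      exact .inr ⟨w, sbw, swc, daw, hD.double_of_path sbw swc F.adj_cb⟩
  · exact .inl (F.classOf_of_single_left swa dwb)

theorem classOf_eq_of_nontrivial (F : Fan D a b c d) (hD : IsConsistent D)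
    (nab : (classOf D a b).Nontrivial) (nac : (classOf D a c).Nontrivial)
    (hne : classOf D b c ≠ classOf D a c) : classOf D a d = classOf D a c := by
  rcases F.classOf_eq_or_exists_chain hD nab with (h | h) | ⟨w, sbw, swc, daw, dbc⟩
  · exact h
  · exact absurd h.1 hne
  · exact absurd (hD.classOf_eq_of_chain F.single_ab sbw swc daw dbc F.single_ac nac) hne

theorem false_of_chain (F : Fan D a b c d) (hD : IsConsistent D) (sbw : Single D b w)
    (swc : Single D w c) (daw : Double D a w) (dbc : Double D b c) (pad : Proper D a d)
    (hne : classOf D b d ≠ classOf D a d) : False := by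
  have hab_aw := F.single_ab.classOf_left sbw daw
  have hbw_aw := F.single_ab.classOf_right sbw daw
  have hbd_aw : classOf D b d = classOf D a w := by
    rw [← F.classOf_bc, ← sbw.classOf_left swc dbc, hbw_aw]
  have hdb : D.Adj d b := by
    by_contra hdb
    rcases hD.classOf_eq_left_or_right F.single_ab ⟨F.adj_bd, hdb⟩ F.adj_ad pad with h | h
    · exact hne (by rw [h, hbd_aw, hab_aw])
    · exact hne h.symm
  have hda : ¬ D.Adj d a := fun hda =>
    hne (classOf_swap_eq (classOf_eq_of_path F.adj_bd hda F.single_ab.2))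
  have nad : (classOf D a d).Nontrivial := pad.resolve_right fun h => hda h.2
  have hdw : D.Adj d w := by
    by_contra hdw
    have hne' : d ≠ w := fun h => hda (h ▸ daw.2)
    exact hne <| hD.classOf_eq_of_chain F.single_ab sbw (hD.single_of_not_adj hne' hdw) daw
      ⟨F.adj_bd, hdb⟩ ⟨F.adj_ad, hda⟩ nad
  by_cases hwd : D.Adj w d
  · have hwd_bd := classOf_swap_eq (classOf_eq_of_path hwd hdb sbw.2)
    have hwd_wa := classOf_eq_of_path hdw daw.2 hda
    refine F.classOf_ne ?_
    rw [F.classOf_bc, ← hwd_bd, hwd_wa, classOf_swap_eq hab_aw]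
  · exact hne (hbd_aw.trans (classOf_eq_of_path daw.2 F.adj_ad hwd))

theorem classOf_eq_of_proper (F : Fan D a b c d) (hD : IsConsistent D)
    (nab : (classOf D a b).Nontrivial) (pad : Proper D a d)
    (hne : classOf D b d ≠ classOf D a d) : classOf D a d = classOf D a c := by
  rcases F.classOf_eq_or_exists_chain hD nab with (h | ⟨-, hab_ac, hdb⟩) | ⟨w, sbw, swc, daw, dbc⟩
  · exact h
  · rcases hD.classOf_eq_left_or_right F.single_ab ⟨F.adj_bd, hdb⟩ F.adj_ad pad with h | h
    · rw [h, hab_ac]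
    · exact absurd h.symm hne
  · exact (F.false_of_chain hD sbw swc daw dbc pad hne).elim

end Fan

namespace IsConsistent

theorem classOf_eq_of_forcing_path (hD : IsConsistent D) (hcb : D.Adj c b) (hbd : D.Adj b d)
    (hcd : ¬ D.Adj c d) (hne : c ≠ d) (pab : Proper D a b) (pac : Proper D a c)
    (hbc_ac : classOf D b c ≠ classOf D a c) (hbc_ba : classOf D b c ≠ classOf D b a) :
    classOf D a d = classOf D a c := by
  have hbc_bd : classOf D b c = classOf D b d := classOf_eq_of_path hcb hbd hcd
  have sdc : Single D d c := hD.single_of_not_adj hne hcd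
  by_cases hca : D.Adj c a
  · by_cases had : D.Adj a d
    · exact (classOf_eq_of_path hca had hcd).symm
    have hne' : a ≠ d := by
      rintro rfl
      exact hbc_ba hbc_bd
    have sda : Single D d a := hD.single_of_not_adj hne' had
    have hab : ¬ D.Adj a b := fun hab =>
      hbc_ba (hbc_bd.trans (classOf_eq_of_path hab hbd had).symm)
    have sba : Single D b a := hD.single_of_not_adj (hD.ne_of_proper pab) hab
    have nab : (classOf D a b).Nontrivial := pab.resolve_right fun h => hab h.1
    have F : Fan (ComparabilityDigraph.rev D) a b d c :=
      ⟨hbd, hcb, sdc, sba, sda, hca, by rwa [classOf_rev, classOf_rev, ← hbc_bd]⟩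
    have hac_ad := F.classOf_eq_of_proper hD.rev (by rwa [classOf_rev]) (proper_rev.2 pac)
      (by rwa [classOf_rev, classOf_rev])
    rw [classOf_rev, classOf_rev] at hac_ad
    exact hac_ad.symm
  · have sac : Single D a c := hD.single_of_not_adj (hD.ne_of_proper pac).symm hca
    have hba : ¬ D.Adj b a := fun hba => hbc_ba (classOf_eq_of_path hcb hba hca)
    have sab : Single D a b := hD.single_of_not_adj (hD.ne_of_proper pab).symm hba
    have had : D.Adj a d := by
      by_contra had
      exact hbc_ba (hbc_bd.trans (classOf_eq_of_path sab.1 hbd had).symm)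
    have F : Fan D a b c d := ⟨hcb, hbd, sdc, sab, sac, had, hbc_ba⟩
    exact F.classOf_eq_of_nontrivial hD (pab.resolve_right fun h => hba h.2)
      (pac.resolve_right fun h => hca h.2) hbc_ac

theorem classOf_eq_of_directlyForces (hD : IsConsistent D)
    (h : DirectlyForces D (b, c) (b, d)) (pab : Proper D a b) (pac : Proper D a c)
    (hbc_ac : classOf D b c ≠ classOf D a c) (hbc_ba : classOf D b c ≠ classOf D b a) :
    classOf D a d = classOf D a c := by
  by_cases hne : c = d
  · rw [hne]
  rcases h.cases_left hne with ⟨hcb, hbd, hcd⟩ | ⟨hdb, hbc, hdc⟩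
  · exact hD.classOf_eq_of_forcing_path hcb hbd hcd hne pab pac hbc_ac hbc_ba
  · have had_ac := hD.rev.classOf_eq_of_forcing_path (a := a) hbc hdb hdc hne
      (proper_rev.2 pab) (proper_rev.2 pac)
    simp only [classOf_rev] at had_ac
    exact had_ac hbc_ac hbc_ba

theorem triangle (hD : IsConsistent D) (pab : Proper D a b) (pac : Proper D a c)
    (hbc_ac : classOf D b c ≠ classOf D a c) (hbc_ba : classOf D b c ≠ classOf D b a)
    (hbc : b ≠ c) {b' c' : V} (h : classOf D b' c' = classOf D b c) :
    classOf D a b' = classOf D a b ∧ classOf D a c' = classOf D a c := by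
  have forcing_step : ∀ p q : V × V, classOf D p.1 p.2 = classOf D b c →
      classOf D a p.1 = classOf D a b ∧ classOf D a p.2 = classOf D a c → DirectlyForces D p q →
      classOf D a q.1 = classOf D a b ∧ classOf D a q.2 = classOf D a c := by
    rintro ⟨x, y⟩ ⟨x', y'⟩ hxy ⟨hax, hay⟩ hf
    dsimp only at hxy hax hay ⊢
    have hxy_ay : classOf D x y ≠ classOf D a y := by rwa [hxy, hay]
    have hxy_xa : classOf D x y ≠ classOf D x a := by rwa [hxy, classOf_swap_eq hax]
    obtain rfl | rfl : x = x' ∨ y = y' := hf.fst_eq_or_snd_eq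
    · exact ⟨hax, (hD.classOf_eq_of_directlyForces hf (pab.congr hax) (pac.congr hay)
        hxy_ay hxy_xa).trans hay⟩
    · refine ⟨(hD.classOf_eq_of_directlyForces hf.swap (pac.congr hay) (pab.congr hax)
        (fun h => hxy_xa (classOf_swap_eq h)) fun h => hxy_ay (classOf_swap_eq h)).trans hax, hay⟩
  have orbit : ∀ q ∈ classOf D b c,
      classOf D a q.1 = classOf D a b ∧ classOf D a q.2 = classOf D a c := by
    intro q hq
    induction hq with
    | single hf => exact forcing_step _ _ rfl ⟨rfl, rfl⟩ hf
    | tail hp hf ih => exact forcing_step _ _ (classOf_eq_of_mem hp) ih hf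
  exact orbit (b', c') (mem_classOf_of_eq h (hD.mem_pairs.2 hbc))

end IsConsistent

end Triangle

section ImproperTriangles

variable {v w : V}

theorem Improper.adj_left (h : Improper D x z) (hwx : D.Adj w x) : D.Adj w z := by
  by_contra hwz
  have hne : (x, w) ≠ (x, z) := fun e => h.1.2 (Prod.mk.inj e |>.2 ▸ hwx)
  exact h.2 (nontrivial_classOf_of_eq (classOf_eq_of_path hwx h.1.1 hwz) (.inl h.1.1) hne)

theorem Improper.adj_right (h : Improper D x z) (hzw : D.Adj z w) : D.Adj x w :=
  (improper_rev.2 h).adj_left hzw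

theorem IsSemicomplete.improper_or_improper (hD : IsSemicomplete D) (hne : x ≠ z)
    (h : ¬ Proper D x z) : Improper D x z ∨ Improper D z x := by
  have hxz : ¬ (classOf D x z).Nontrivial := fun h' => h (.inl h')
  rcases hD.total x z hne with hs | hs
  · exact .inl ⟨⟨hs, fun h' => h (.inr ⟨hs, h'⟩)⟩, hxz⟩
  · exact .inr ⟨⟨hs, fun h' => h (.inr ⟨h', hs⟩)⟩, fun h' => hxz (nontrivial_classOf_symm h')⟩

/-- An improper arc `xz` with a vertex `y` that a partial orientation may place between its ends:
`(x, y)` and `(y, z)` are proper and the classes do not put `x` and `z` on the same side of `y`. -/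
structure ImproperTriangle (D : Digraph V) (x y z : V) : Prop where
  improper : Improper D x z
  proper_left : Proper D x y
  proper_right : Proper D y z
  classOf_ne : classOf D y x ≠ classOf D y z

namespace ImproperTriangle

theorem rev (h : ImproperTriangle D x y z) : ImproperTriangle (rev D) z y x where
  improper := improper_rev.2 h.improper
  proper_left := proper_rev.2 h.proper_right.symm
  proper_right := proper_rev.2 h.proper_left.symm
  classOf_ne := by
    rw [classOf_rev, classOf_rev]
    exact h.classOf_ne.symm

theorem not_adj_of_adj (h : ImproperTriangle D x y z) (hzy : D.Adj z y) : ¬ D.Adj y x :=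
  fun hyx => h.classOf_ne (classOf_eq_of_path hzy hyx h.improper.1.2).symm

theorem exists_path_of_adj (h : ImproperTriangle D x y z) (hD : IsConsistent D)
    (hyx : D.Adj y x) : ∃ w, Single D x w ∧ Single D w y ∧ Double D w z := by
  have hzy : ¬ D.Adj z y := fun hzy => h.not_adj_of_adj hzy hyx
  have syz : Single D y z := hD.single_of_not_adj (hD.ne_of_proper h.proper_right).symm hzy
  have nyz : (classOf D y z).Nontrivial := h.proper_right.resolve_right fun h => hzy h.2
  rcases hD.exists_detour syz nyz with ⟨w, szw, dyw⟩ | ⟨w, swy, dwz⟩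
  · have hwx : ¬ D.Adj w x := fun hwx => szw.2 (h.improper.adj_left hwx)
    refine absurd ?_ h.classOf_ne
    rw [syz.classOf_left szw dyw, classOf_eq_of_path dyw.2 hyx hwx]
  · refine ⟨w, ⟨h.improper.adj_right dwz.2, fun hwx => h.classOf_ne ?_⟩, swy, dwz⟩
    have hxy_xw := classOf_eq_of_path hyx (h.improper.adj_right dwz.2) swy.2
    have hwz_wx := classOf_eq_of_path dwz.2 hwx h.improper.1.2
    rw [classOf_swap_eq hxy_xw, ← hwz_wx, swy.classOf_right syz dwz]

theorem adj_left (h : ImproperTriangle D x y z) (hD : IsConsistent D) : D.Adj x y := by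
  by_contra hxy
  have syx : Single D y x := hD.single_of_not_adj (hD.ne_of_proper h.proper_left) hxy
  obtain ⟨w, sxw, swy, -⟩ := h.exists_path_of_adj hD syx.1
  exact hxy (hD.double_of_path sxw swy syx.1).1

theorem adj_right (h : ImproperTriangle D x y z) (hD : IsConsistent D) : D.Adj y z :=
  h.rev.adj_left hD.rev

theorem classOf_eq_of_adj (h : ImproperTriangle D x y z) (hD : IsConsistent D)
    (hyx : D.Adj y x) : classOf D x y = classOf D y z := by
  obtain ⟨w, sxw, swy, dwz⟩ := h.exists_path_of_adj hD hyx
  have syz : Single D y z := ⟨h.adj_right hD, fun hzy => h.not_adj_of_adj hzy hyx⟩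
  rw [← sxw.classOf_right swy ⟨h.adj_left hD, hyx⟩, swy.classOf_left syz dwz,
    swy.classOf_right syz dwz]

theorem classOf_eq_of_after_after (h : ImproperTriangle D x y z) (hD : IsConsistent D)
    (sxy : Single D x y) (syz : Single D y z) (syv : Single D y v) (dxv : Double D x v)
    (szw : Single D z w) (dyw : Double D y w) : classOf D x y = classOf D y z := by
  have hxy_xv := sxy.classOf_left syv dxv
  have hyz_yw := syz.classOf_left szw dyw
  have hwx : ¬ D.Adj w x := fun hwx => szw.2 (h.improper.adj_left hwx)
  by_cases hwv : D.Adj w v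
  · by_cases hvw : D.Adj v w
    · have hwv_wy := classOf_eq_of_path hvw dyw.2 syv.2
      have hvw_vx := classOf_eq_of_path hwv dxv.2 hwx
      refine absurd ?_ h.classOf_ne
      rw [classOf_swap_eq hxy_xv, ← hvw_vx, classOf_swap_eq hwv_wy, hyz_yw]
    · have swv : Single D w v := ⟨hwv, hvw⟩
      have sxw : Single D x w := ⟨h.improper.adj_right szw.1, hwx⟩
      have dzv := hD.double_of_path szw swv (h.improper.adj_left dxv.2)
      rw [hxy_xv, ← sxw.classOf_right swv dxv, szw.classOf_right swv dzv,
        ← szw.classOf_left swv dzv, syz.classOf_right szw dyw, hyz_yw]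
  · rw [hxy_xv, ← sxy.classOf_right syv dxv, ← classOf_eq_of_path dyw.2 syv.1 hwv, hyz_yw]

theorem classOf_eq_of_after_before (h : ImproperTriangle D x y z) (hD : IsConsistent D)
    (sxy : Single D x y) (syz : Single D y z) (syv : Single D y v) (dxv : Double D x v)
    (swy : Single D w y) (dwz : Double D w z) : classOf D x y = classOf D y z := by
  have hxy_xv := sxy.classOf_left syv dxv
  have hyz_wz := swy.classOf_right syz dwz
  have hwv : D.Adj w v := by
    by_contra hwv
    have hne : w ≠ v := fun e => syv.2 (e ▸ swy.1)
    exact swy.2 (hD.double_of_path syv (hD.single_of_not_adj hne hwv) swy.1).1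
  by_cases hvw : D.Adj v w
  · rw [hxy_xv, ← sxy.classOf_right syv dxv, swy.classOf_right syv ⟨hwv, hvw⟩,
      ← swy.classOf_left syv ⟨hwv, hvw⟩, swy.classOf_left syz dwz, hyz_wz]
  have swv : Single D w v := ⟨hwv, hvw⟩
  have sxw : Single D x w := by
    refine ⟨h.improper.adj_right dwz.2, fun hwx => h.classOf_ne ?_⟩
    have hxv_xw := classOf_eq_of_path dxv.2 (h.improper.adj_right dwz.2) hvw
    have hwz_wx := classOf_eq_of_path dwz.2 hwx h.improper.1.2
    rw [classOf_swap_eq hxy_xv, classOf_swap_eq hxv_xw, ← hwz_wx, hyz_wz]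
  have svz : Single D v z := by
    refine ⟨h.improper.adj_left dxv.2, fun hzv => h.classOf_ne (classOf_swap_eq ?_)⟩
    have hzv_zw := classOf_eq_of_path (h.improper.adj_left dxv.2) dwz.2 hvw
    have hvz_vx := classOf_eq_of_path hzv dxv.2 h.improper.1.2
    rw [hxy_xv, ← classOf_swap_eq hvz_vx, hzv_zw, ← classOf_swap_eq hyz_wz]
  rw [hxy_xv, ← sxw.classOf_right swv dxv, swv.classOf_left svz dwz, hyz_wz]

theorem classOf_eq_of_before_after (h : ImproperTriangle D x y z)
    (sxy : Single D x y) (syz : Single D y z) (svx : Single D v x) (dvy : Double D v y)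
    (szw : Single D z w) (dyw : Double D y w) : classOf D x y = classOf D y z := by
  have hvx_xy := (svx.classOf_left sxy dvy).trans (svx.classOf_right sxy dvy).symm
  have hyz_yw := syz.classOf_left szw dyw
  have hyv_ne_yw : classOf D y v ≠ classOf D y w := fun e => h.classOf_ne <| by
    rw [hyz_yw, ← e, classOf_swap_eq (svx.classOf_right sxy dvy)]
  have dvw : Double D v w :=
    ⟨by_contra fun hvw => hyv_ne_yw (classOf_eq_of_path dvy.1 dyw.1 hvw),
      by_contra fun hwv => hyv_ne_yw (classOf_eq_of_path dyw.2 dvy.2 hwv).symm⟩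
  have sxw : Single D x w :=
    ⟨h.improper.adj_right szw.1, fun hwx => szw.2 (h.improper.adj_left hwx)⟩
  have svz : Single D v z :=
    ⟨h.improper.adj_left svx.1, fun hzv => svx.2 (h.improper.adj_right hzv)⟩
  rw [← hvx_xy, svx.classOf_left sxw dvw, ← svz.classOf_right szw dvw,
    syz.classOf_right szw dyw, hyz_yw]

theorem classOf_eq (h : ImproperTriangle D x y z) (hD : IsConsistent D) :
    classOf D x y = classOf D y z := by
  by_cases hyx : D.Adj y x
  · exact h.classOf_eq_of_adj hD hyx
  by_cases hzy : D.Adj z y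
  · have hzy_yx := h.rev.classOf_eq_of_adj hD.rev hzy
    rw [classOf_rev, classOf_rev] at hzy_yx
    exact (classOf_swap_eq hzy_yx).symm
  have sxy : Single D x y := ⟨h.adj_left hD, hyx⟩
  have syz : Single D y z := ⟨h.adj_right hD, hzy⟩
  rcases hD.exists_detour sxy (h.proper_left.resolve_right fun h => hyx h.2) with
    ⟨v, syv, dxv⟩ | ⟨v, svx, dvy⟩ <;>
  rcases hD.exists_detour syz (h.proper_right.resolve_right fun h => hzy h.2) with
    ⟨w, szw, dyw⟩ | ⟨w, swy, dwz⟩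
  · exact h.classOf_eq_of_after_after hD sxy syz syv dxv szw dyw
  · exact h.classOf_eq_of_after_before hD sxy syz syv dxv swy dwz
  · exact h.classOf_eq_of_before_after sxy syz svx dvy szw dyw
  · have hzy_yx := h.rev.classOf_eq_of_after_after hD.rev syz sxy swy dwz svx dvy
    rw [classOf_rev, classOf_rev] at hzy_yx
    exact (classOf_swap_eq hzy_yx).symm

end ImproperTriangle

theorem IsConsistent.classOf_eq_of_not_proper (hD : IsConsistent D) (hne : x ≠ z)
    (h : ¬ Proper D x z) (pxy : Proper D x y) (pyz : Proper D y z)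
    (hyx_yz : classOf D y x ≠ classOf D y z) : classOf D x y = classOf D y z := by
  rcases hD.improper_or_improper hne h with h | h
  · exact ImproperTriangle.classOf_eq ⟨h, pxy, pyz, hyx_yz⟩ hD
  · have hzy_yx := ImproperTriangle.classOf_eq ⟨h, pyz.symm, pxy.symm, hyx_yz.symm⟩ hD
    exact (classOf_swap_eq hzy_yx).symm

theorem IsConsistent.improper_trans (hD : IsConsistent D) (hxy : Improper D x y)
    (hyz : Improper D y z) : Improper D x z := by
  have hxz : D.Adj x z := hxy.adj_right hyz.1.1
  have sxz : Single D x z := ⟨hxz, fun hzx => hxy.1.2 (hyz.adj_right hzx)⟩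
  refine ⟨sxz, fun nxz => ?_⟩
  rcases hD.exists_detour sxz nxz with ⟨w, szw, dxw⟩ | ⟨w, swx, dwz⟩
  · exact szw.2 (hyz.adj_left (hxy.adj_left dxw.2))
  · exact swx.2 (hxy.adj_right (hyz.adj_right dwz.2))

end ImproperTriangles

/-- `T` is an asymmetric union of implication classes of proper pairs. -/
structure IsPartialOrientation (D : Digraph V) (T : V → V → Prop) : Prop where
  proper : ∀ {x y}, T x y → Proper D x y
  congr : ∀ {x y x' y'}, T x y → classOf D x' y' = classOf D x y → T x' y'
  asymm : ∀ {x y}, T x y → ¬ T y x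

/-- A partial orientation that is transitive as far as proper pairs are concerned. -/
structure IsClosedOrientation (D : Digraph V) (T : V → V → Prop) : Prop
    extends IsPartialOrientation D T where
  trans : ∀ {x y z}, T x y → T y z → Proper D x z → T x z

section Orientations

variable {T : V → V → Prop} {u v : V}

namespace IsPartialOrientation

theorem swap (hT : IsPartialOrientation D T) : IsPartialOrientation D (Function.swap T) where
  proper h := (hT.proper h).symm
  congr h e := hT.congr h (classOf_swap_eq e)
  asymm h := hT.asymm h

theorem ne_of_path (hT : IsPartialOrientation D T) (hxy : T x y) (hyz : T y z) : x ≠ z := by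
  rintro rfl
  exact hT.asymm hxy hyz

theorem classOf_ne_left (hT : IsPartialOrientation D T) (hxy : T x y) (hyz : T y z) :
    classOf D y x ≠ classOf D y z :=
  fun h => hT.asymm hxy (hT.congr hyz h)

theorem classOf_ne_right (hT : IsPartialOrientation D T) (hxy : T x y) (hyz : T y z) :
    classOf D x y ≠ classOf D z y :=
  fun h => hT.classOf_ne_left hxy hyz (classOf_swap_eq h)

theorem ne (hT : IsPartialOrientation D T) (hD : IsConsistent D) (hxy : T x y) : x ≠ y :=
  hD.ne_of_proper (hT.proper hxy)

theorem classOf_eq_of_not_proper (hT : IsPartialOrientation D T) (hD : IsConsistent D)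
    (hxy : T x y) (hyz : T y z) (h : ¬ Proper D x z) : classOf D x y = classOf D y z :=
  hD.classOf_eq_of_not_proper (hT.ne_of_path hxy hyz) h (hT.proper hxy) (hT.proper hyz)
    (hT.classOf_ne_left hxy hyz)

theorem not_four_cycle_of_improper (hT : IsPartialOrientation D T) (hD : IsConsistent D)
    {x₀ x₁ x₂ x₃ : V} (h₀₁ : T x₀ x₁) (h₁₂ : T x₁ x₂) (h₂₃ : T x₂ x₃) (h₃₀ : T x₃ x₀)
    (h₀₂ : Improper D x₀ x₂) (h₁₃ : Improper D x₁ x₃) : False := by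
  have Δ₀₁₂ : ImproperTriangle D x₀ x₁ x₂ :=
    ⟨h₀₂, hT.proper h₀₁, hT.proper h₁₂, hT.classOf_ne_left h₀₁ h₁₂⟩
  have Δ₀₃₂ : ImproperTriangle D x₀ x₃ x₂ :=
    ⟨h₀₂, (hT.proper h₃₀).symm, (hT.proper h₂₃).symm, (hT.classOf_ne_left h₂₃ h₃₀).symm⟩
  have Δ₁₀₃ : ImproperTriangle D x₁ x₀ x₃ :=
    ⟨h₁₃, (hT.proper h₀₁).symm, (hT.proper h₃₀).symm, (hT.classOf_ne_left h₃₀ h₀₁).symm⟩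
  have adj₁₀ := Δ₁₀₃.adj_left hD
  have s₁₂ : Single D x₁ x₂ := ⟨Δ₀₁₂.adj_right hD, fun h => Δ₀₁₂.not_adj_of_adj h adj₁₀⟩
  obtain ⟨w, -, sw₁, dw₂⟩ := Δ₀₁₂.exists_path_of_adj hD adj₁₀
  have not_adj₃w : ¬ D.Adj x₃ w := fun h => sw₁.2 (h₁₃.adj_right h)
  refine hT.classOf_ne_left h₁₂ h₂₃ ?_
  rw [classOf_swap_eq (sw₁.classOf_right s₁₂ dw₂),
    classOf_eq_of_path (Δ₀₃₂.adj_right hD) dw₂.2 not_adj₃w]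

theorem not_four_cycle (hT : IsPartialOrientation D T) (hD : IsConsistent D)
    {x₀ x₁ x₂ x₃ : V} (h₀₁ : T x₀ x₁) (h₁₂ : T x₁ x₂) (h₂₃ : T x₂ x₃) (h₃₀ : T x₃ x₀)
    (h₀₂ : ¬ Proper D x₀ x₂) (h₁₃ : ¬ Proper D x₁ x₃) : False := by
  rcases hD.improper_or_improper (hT.ne_of_path h₀₁ h₁₂) h₀₂ with h₀₂ | h₂₀ <;>
  rcases hD.improper_or_improper (hT.ne_of_path h₁₂ h₂₃) h₁₃ with h₁₃ | h₃₁
  · exact hT.not_four_cycle_of_improper hD h₀₁ h₁₂ h₂₃ h₃₀ h₀₂ h₁₃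
  · exact hT.not_four_cycle_of_improper hD h₃₀ h₀₁ h₁₂ h₂₃ h₃₁ h₀₂
  · exact hT.not_four_cycle_of_improper hD h₁₂ h₂₃ h₃₀ h₀₁ h₁₃ h₂₀
  · exact hT.not_four_cycle_of_improper hD h₂₃ h₃₀ h₀₁ h₁₂ h₂₀ h₃₁

theorem union_classOf (hT : IsPartialOrientation D T) (hD : IsConsistent D) (puv : Proper D u v)
    (hvu : ¬ T v u) :
    IsPartialOrientation D (fun x y => T x y ∨ classOf D x y = classOf D u v) where
  proper h := h.elim hT.proper puv.congr
  congr h e := h.imp (fun h => hT.congr h e) e.trans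
  asymm {x y} := by
    rintro (hxy | hxy) (hyx | hyx)
    · exact hT.asymm hxy hyx
    · exact hvu (hT.congr hxy (classOf_swap_eq hyx).symm)
    · exact hvu (hT.congr hyx (classOf_swap_eq hxy).symm)
    · exact hD.classOf_ne u v (hD.ne_of_proper puv) (hxy.symm.trans (classOf_swap_eq hyx))

end IsPartialOrientation

/-- The relation `T` together with all pairs that are decided once `u` is put before `v`:
the classes of the pairs `(s, t)` with `s ≤ u` and `v ≤ t` in `T`. -/
def adjoin (D : Digraph V) (T : V → V → Prop) (u v x y : V) : Prop :=
  T x y ∨ Proper D x y ∧ ∃ s t, classOf D s t = classOf D x y ∧ ReflGen T s u ∧ ReflGen T v t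

theorem reflGen_swap {α : Type*} {r : α → α → Prop} {a b : α} (h : ReflGen r a b) :
    ReflGen (Function.swap r) b a := by
  rcases h with _ | h
  exacts [.refl, .single h]

theorem adjoin_swap (h : adjoin D T u v x y) : adjoin D (Function.swap T) v u y x := by
  obtain h | ⟨pxy, s, t, e, hs, ht⟩ := h
  · exact .inl h
  · exact .inr ⟨pxy.symm, t, s, classOf_swap_eq e, reflGen_swap ht, reflGen_swap hs⟩

namespace IsClosedOrientation

theorem swap (hT : IsClosedOrientation D T) : IsClosedOrientation D (Function.swap T) where
  toIsPartialOrientation := hT.toIsPartialOrientation.swap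
  trans hxy hyz pxz := hT.trans hyz hxy pxz.symm

theorem not_of_adjoin (hT : IsClosedOrientation D T) (hD : IsConsistent D) (puv : Proper D u v)
    (hvu : ¬ T v u) {s t : V} (hs : ReflGen T s u) (ht : ReflGen T v t) : ¬ T t s := by
  intro hts
  rcases hs with _ | hs <;> rcases ht with _ | ht
  · exact hvu hts
  · exact hvu (hT.trans ht hts puv.symm)
  · exact hvu (hT.trans hts hs puv.symm)
  · by_cases pvs : Proper D v s
    · exact hvu (hT.trans (hT.trans ht hts pvs) hs puv.symm)
    by_cases ptu : Proper D t u
    · exact hvu (hT.trans ht (hT.trans hts hs ptu) puv.symm)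
    exact (hT.union_classOf hD puv hvu).not_four_cycle hD (.inl ht) (.inl hts) (.inl hs)
      (.inr rfl) pvs ptu

theorem classOf_eq_of_opposite (hT : IsClosedOrientation D T) (hD : IsConsistent D)
    (puv : Proper D u v) (huv : ¬ T u v) (hvu : ¬ T v u) {s t s' t' : V}
    (hs : ReflGen T s u) (ht : ReflGen T v t) (hs' : ReflGen T s' u) (ht' : ReflGen T v t')
    (pst : Proper D s t) (h : classOf D t' s' = classOf D s t) :
    classOf D s t = classOf D u v := by
  have not_T_ts : ¬ T t' s' := hT.not_of_adjoin hD puv hvu hs' ht'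
  have put : Proper D u t := by
    rcases ht with _ | ht
    · exact puv
    · by_contra put
      exact huv <| hT.congr ht <|
        (hT.union_classOf hD puv hvu).classOf_eq_of_not_proper hD (.inr rfl) (.inl ht) put
  have hst_ut : classOf D s t = classOf D u t := by
    rcases hs with _ | hs
    · rfl
    · by_contra hst_ut
      have hst_su : classOf D s t ≠ classOf D s u := fun e => not_T_ts (hT.congr hs (h.trans e))
      have hut'_us := (hD.triangle (hT.proper hs).symm put hst_ut hst_su
        (hD.ne_of_proper pst) h).1
      exact hT.not_of_adjoin hD puv hvu .refl ht' (hT.congr hs (classOf_swap_eq hut'_us))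
  rcases ht with _ | ht
  · exact hst_ut
  · by_contra hne
    rw [hst_ut] at hne h
    have hut_vt : classOf D u t ≠ classOf D v t := fun e => not_T_ts (hT.congr ht (h.trans e))
    have hvs'_vt := (hD.triangle puv.symm (hT.proper ht) hut_vt hne (hD.ne_of_proper put) h).2
    exact hT.not_of_adjoin hD puv hvu hs' .refl (hT.congr ht hvs'_vt)

theorem isPartialOrientation_adjoin (hT : IsClosedOrientation D T) (hD : IsConsistent D)
    (puv : Proper D u v) (huv : ¬ T u v) (hvu : ¬ T v u) :
    IsPartialOrientation D (adjoin D T u v) where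
  proper h := h.elim hT.proper fun h => h.1
  congr := by
    rintro x y x' y' (h | ⟨pxy, s, t, hst, hs, ht⟩) e
    · exact .inl (hT.congr h e)
    · exact .inr ⟨pxy.congr e, s, t, hst.trans e.symm, hs, ht⟩
  asymm := by
    rintro x y (hxy | ⟨pxy, s, t, hst, hs, ht⟩) (hyx | ⟨pyx, s', t', hst', hs', ht'⟩)
    · exact hT.asymm hxy hyx
    · exact hT.not_of_adjoin hD puv hvu hs' ht' (hT.congr hxy (classOf_swap_eq hst'))
    · exact hT.not_of_adjoin hD puv hvu hs ht (hT.congr hyx (classOf_swap_eq hst))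
    · have hts'_st : classOf D t' s' = classOf D s t := (classOf_swap_eq hst').trans hst.symm
      have hst_uv := hT.classOf_eq_of_opposite hD puv huv hvu hs ht hs' ht' (pxy.congr hst) hts'_st
      have hst'_uv := hT.classOf_eq_of_opposite hD puv huv hvu hs' ht' hs ht (pyx.congr hst')
        (classOf_swap_eq hts'_st).symm
      exact hD.classOf_ne u v (hD.ne_of_proper puv) <|
        hst_uv.symm.trans (hts'_st.symm.trans (classOf_swap_eq hst'_uv))

theorem adjoin_trans_left (hT : IsClosedOrientation D T) (hD : IsConsistent D)
    (puv : Proper D u v) (huv : ¬ T u v) (hvu : ¬ T v u) (hxy : T x y)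
    (hyz : adjoin D T u v y z) (pxz : Proper D x z) : adjoin D T u v x z := by
  have hE := hT.isPartialOrientation_adjoin hD puv huv hvu
  by_cases hxz_xy : classOf D x z = classOf D x y
  · exact .inl (hT.congr hxy hxz_xy)
  by_cases hxz_yz : classOf D x z = classOf D y z
  · exact hE.congr hyz hxz_yz
  rcases id hyz with hyz' | ⟨-, s, t, hst, hs, ht⟩
  · exact .inl (hT.trans hxy hyz' pxz)
  obtain ⟨hxs_xy, hxt_xz⟩ := hD.triangle (hT.proper hxy) pxz (Ne.symm hxz_yz)
    (hE.classOf_ne_left (.inl hxy) hyz).symm (hE.ne hD hyz) hst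
  have hxs : T x s := hT.congr hxy hxs_xy
  refine .inr ⟨pxz, x, t, hxt_xz, ?_, ht⟩
  rcases hs with _ | hs
  · exact .single hxs
  refine .single <| by_contra fun hxu => hxz_yz ?_
  have hxs_su : classOf D x s = classOf D s u :=
    hT.classOf_eq_of_not_proper hD hxs hs fun pxu => hxu (hT.trans hxs hs pxu)
  have hE_st := hE.congr hyz hst
  have hts_tx := (hD.triangle (pxz.congr hxt_xz).symm (hE.proper hE_st).symm
    (hE.classOf_ne_right (.inl hxs) hE_st) (by rw [hxs_xy, hxt_xz]; exact Ne.symm hxz_xy)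
    (hT.ne hD hxs) hxs_su.symm).1
  rw [← hst, classOf_swap_eq hts_tx, hxt_xz]

theorem adjoin_trans_right (hT : IsClosedOrientation D T) (hD : IsConsistent D)
    (puv : Proper D u v) (huv : ¬ T u v) (hvu : ¬ T v u) (hxy : adjoin D T u v x y)
    (hyz : T y z) (pxz : Proper D x z) : adjoin D T u v x z :=
  adjoin_swap <| hT.swap.adjoin_trans_left hD puv.symm huv hvu hyz (adjoin_swap hxy) pxz.symm

theorem isClosedOrientation_adjoin (hT : IsClosedOrientation D T) (hD : IsConsistent D)
    (puv : Proper D u v) (huv : ¬ T u v) (hvu : ¬ T v u) :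
    IsClosedOrientation D (adjoin D T u v) where
  toIsPartialOrientation := hT.isPartialOrientation_adjoin hD puv huv hvu
  trans {x y z} hxy hyz pxz := by
    have hE := hT.isPartialOrientation_adjoin hD puv huv hvu
    rcases id hxy with hxy' | ⟨-, s, t, hst, hs, -⟩
    · exact hT.adjoin_trans_left hD puv huv hvu hxy' hyz pxz
    rcases id hyz with hyz' | ⟨-, s', t', hst', -, ht'⟩
    · exact hT.adjoin_trans_right hD puv huv hvu hxy hyz' pxz
    by_cases hxz_xy : classOf D x z = classOf D x y
    · exact hE.congr hxy hxz_xy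
    by_cases hxz_yz : classOf D x z = classOf D y z
    · exact hE.congr hyz hxz_yz
    obtain ⟨hzs_zx, hzt_zy⟩ := hD.triangle pxz.symm (hE.proper hyz).symm
      (hE.classOf_ne_right hxy hyz) (Ne.symm hxz_xy) (hE.ne hD hxy) hst
    have hsz_xz := classOf_swap_eq hzs_zx
    have htz_yz := classOf_swap_eq hzt_zy
    have hE_st := hE.congr hxy hst
    have hE_tz := hE.congr hyz htz_yz
    have hst'_sz := (hD.triangle (hE.proper hE_st) (pxz.congr hsz_xz)
      (by rw [hsz_xz, htz_yz]; exact Ne.symm hxz_yz) (hE.classOf_ne_left hE_st hE_tz).symm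
      (hE.ne hD hE_tz) (hst'.trans htz_yz.symm)).2
    exact .inr ⟨pxz, s, t', hst'_sz.trans hsz_xz, hs, ht'⟩

theorem exists_extension (hT : IsClosedOrientation D T) (hD : IsConsistent D)
    (puv : Proper D u v) (hvu : ¬ T v u) : ∃ T', IsClosedOrientation D T' ∧ T ≤ T' ∧ T' u v := by
  by_cases huv : T u v
  · exact ⟨T, hT, le_rfl, huv⟩
  · exact ⟨_, hT.isClosedOrientation_adjoin hD puv huv hvu, fun _ _ => .inl,
      .inr ⟨puv, u, v, rfl, .refl, .refl⟩⟩

theorem of_chain {𝒯 : Set (V → V → Prop)} (h𝒯 : ∀ T ∈ 𝒯, IsClosedOrientation D T)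
    (hc : IsChain (· ≤ ·) 𝒯) : IsClosedOrientation D (fun x y => ∃ T ∈ 𝒯, T x y) := by
  have common : ∀ {x y z w}, (∃ T ∈ 𝒯, T x y) → (∃ T ∈ 𝒯, T z w) → ∃ T ∈ 𝒯, T x y ∧ T z w := by
    rintro x y z w ⟨S, hS, hxy⟩ ⟨T, hT, hzw⟩
    rcases hc.total hS hT with hle | hle
    exacts [⟨T, hT, hle x y hxy, hzw⟩, ⟨S, hS, hxy, hle z w hzw⟩]
  refine ⟨⟨?_, ?_, ?_⟩, ?_⟩
  · rintro x y ⟨T, hT, hxy⟩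
    exact (h𝒯 T hT).proper hxy
  · rintro x y x' y' ⟨T, hT, hxy⟩ e
    exact ⟨T, hT, (h𝒯 T hT).congr hxy e⟩
  · intro x y hxy hyx
    obtain ⟨T, hT, hxy, hyx⟩ := common hxy hyx
    exact (h𝒯 T hT).asymm hxy hyx
  · intro x y z hxy hyz pxz
    obtain ⟨T, hT, hxy, hyz⟩ := common hxy hyz
    exact ⟨T, hT, (h𝒯 T hT).trans hxy hyz pxz⟩

theorem exists_total (hT : IsClosedOrientation D T) (hD : IsConsistent D) :
    ∃ T', IsClosedOrientation D T' ∧ T ≤ T' ∧ ∀ x y, Proper D x y → T' x y ∨ T' y x := by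
  obtain ⟨M, hTM, hM⟩ := zorn_le_nonempty₀ {T' | IsClosedOrientation D T'}
    (fun 𝒯 h𝒯 hc _ _ => ⟨_, of_chain h𝒯 hc, fun S hS _ _ hxy => ⟨S, hS, hxy⟩⟩) T hT
  refine ⟨M, hM.1, hTM, fun x y pxy => or_iff_not_imp_right.2 fun hyx => ?_⟩
  obtain ⟨T', hT', hle, hxy⟩ := exists_extension hM.1 hD pxy hyx
  exact hM.2 hT' hle x y hxy

end IsClosedOrientation

end Orientations

/-- There is a `T`-walk with exactly `n` steps from `x` to `y`. -/
def HasWalk {α : Type*} (T : α → α → Prop) : ℕ → α → α → Prop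
  | 0, x, y => x = y
  | n + 1, x, z => ∃ y, T x y ∧ HasWalk T n y z

section Acyclicity

variable {T R : V → V → Prop} {i j k n : ℕ}

namespace HasWalk

theorem trans (hxy : HasWalk T i x y) (hyz : HasWalk T j y z) : HasWalk T (i + j) x z := by
  induction i generalizing x with
  | zero =>
    obtain rfl : x = y := hxy
    rwa [zero_add]
  | succ i ih =>
    obtain ⟨w, hxw, hwy⟩ := hxy
    rw [Nat.succ_add_eq_add_succ]
    exact ⟨w, hxw, ih hwy⟩

theorem single (hxy : T x y) : HasWalk T 1 x y := ⟨y, hxy, rfl⟩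

theorem exists_of_transGen (h : TransGen T x y) : ∃ n > 0, HasWalk T n x y := by
  induction h with
  | single hxy => exact ⟨1, one_pos, .single hxy⟩
  | tail _ hyz ih =>
    obtain ⟨n, -, hn⟩ := ih
    exact ⟨n + 1, n.succ_pos, hn.trans (.single hyz)⟩

end HasWalk

/-- `R` is a transitive relation that orients all chords of the closed `T`-walks of length `n`, and
no arc of `T`. -/
structure OrientsChords (T R : V → V → Prop) (n : ℕ) : Prop where
  trans : ∀ {x y z}, R x y → R y z → R x z
  not_left : ∀ {x y}, T x y → ¬ R x y
  not_right : ∀ {x y}, T x y → ¬ R y x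
  chord : ∀ {i j x y}, 2 ≤ i → 2 ≤ j → i + j = n → HasWalk T i x y → HasWalk T j y x →
    R x y ∨ R y x

namespace OrientsChords

theorem symm (h : OrientsChords T R n) : OrientsChords T (fun x y => R y x) n where
  trans hxy hyz := h.trans hyz hxy
  not_left := h.not_right
  not_right := h.not_left
  chord hi hj hn wxy wyx := (h.chord hi hj hn wxy wyx).symm

theorem of_walk (h : OrientsChords T R n) (hi : 2 ≤ i) (hk : 2 ≤ k) (hn : i + j + k = n)
    (Rxy : R x y) (wxy : HasWalk T i x y) (wyz : HasWalk T j y z) (wzx : HasWalk T k z x) :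
    R x z := by
  induction j generalizing i y with
  | zero =>
    obtain rfl : y = z := wyz
    exact Rxy
  | succ j ih =>
    obtain ⟨w, Tyw, wwz⟩ := wyz
    have wxw := wxy.trans (.single Tyw)
    refine ih (by omega) (by omega) ?_ wxw wwz
    refine (h.chord (by omega) (by omega) (by omega) wxw (wwz.trans wzx)).resolve_right ?_
    exact fun Rwx => h.not_right Tyw (h.trans Rwx Rxy)

theorem of_arc (h : OrientsChords T R n) (hi : 2 ≤ i) (hj : 1 ≤ j) (hn : 1 + i + j = n)
    (Rxz : R x z) (Txy : T x y) (wyz : HasWalk T i y z) (wzx : HasWalk T j z x) : R y z := by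
  refine (h.chord hi (by omega) (by omega) wyz (wzx.trans (.single Txy))).resolve_right ?_
  exact fun Rzy => h.not_left Txy (h.trans Rxz Rzy)

theorem not_first_chord (h : OrientsChords T R (n + 5)) {x₀ x₁ x₂ x₃ x₄ : V} (h₀₁ : T x₀ x₁)
    (h₁₂ : T x₁ x₂) (h₂₃ : T x₂ x₃) (h₃₄ : T x₃ x₄) (h₄₀ : HasWalk T (n + 1) x₄ x₀) :
    ¬ R x₀ x₂ := by
  intro r₀₂
  have w₀₁ : HasWalk T 1 x₀ x₁ := .single h₀₁
  have w₁₂ : HasWalk T 1 x₁ x₂ := .single h₁₂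
  have w₂₃ : HasWalk T 1 x₂ x₃ := .single h₂₃
  have w₃₄ : HasWalk T 1 x₃ x₄ := .single h₃₄
  have w₃₀ := w₃₄.trans h₄₀
  have r₀₃ := h.of_walk (by omega) (by omega) (by omega) r₀₂ (w₀₁.trans w₁₂) w₂₃ w₃₀
  have r₁₃ := h.of_arc (by omega) (by omega) (by omega) r₀₃ h₀₁ (w₁₂.trans w₂₃) w₃₀
  have r₁₄ := h.of_walk (by omega) (by omega) (by omega) r₁₃ (w₁₂.trans w₂₃) w₃₄
    (h₄₀.trans w₀₁)
  have r₂₄ := h.of_arc (by omega) (by omega) (by omega) r₁₄ h₁₂ (w₂₃.trans w₃₄) (h₄₀.trans w₀₁)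
  have r₂₀ := h.of_walk (by omega) (by omega) (by omega) r₂₄ (w₂₃.trans w₃₄) h₄₀
    (w₀₁.trans w₁₂)
  exact h.not_left h₂₃ (h.trans r₂₀ r₀₃)

end OrientsChords

theorem Improper.not_proper (h : Improper D x y) : ¬ Proper D x y :=
  fun p => p.elim h.2 fun d => h.1.2 d.2

theorem Improper.not_proper_symm (h : Improper D x y) : ¬ Proper D y x :=
  fun p => h.not_proper p.symm

namespace HasWalk

theorem not_proper_of_minimal (hT : ∀ x y, Proper D x y → T x y ∨ T y x)
    (hmin : ∀ m < n, 0 < m → ∀ x, ¬ HasWalk T m x x) (hi : 2 ≤ i) (hj : 2 ≤ j) (hn : i + j = n)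
    (wxy : HasWalk T i x y) (wyx : HasWalk T j y x) : ¬ Proper D x y := by
  intro pxy
  rcases hT x y pxy with Txy | Tyx
  · exact hmin (1 + j) (by omega) (by omega) x ((HasWalk.single Txy).trans wyx)
  · exact hmin (i + 1) (by omega) (by omega) x (wxy.trans (.single Tyx))

theorem improper_or_improper_of_minimal (hD : IsConsistent D)
    (hT : ∀ x y, Proper D x y → T x y ∨ T y x)
    (hmin : ∀ m < n, 0 < m → ∀ x, ¬ HasWalk T m x x) (hi : 2 ≤ i) (hj : 2 ≤ j) (hn : i + j = n)
    (wxy : HasWalk T i x y) (wyx : HasWalk T j y x) : Improper D x y ∨ Improper D y x := by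
  refine hD.improper_or_improper ?_ (not_proper_of_minimal hT hmin hi hj hn wxy wyx)
  rintro rfl
  exact hmin i (by omega) (by omega) x wxy

end HasWalk

namespace IsClosedOrientation

theorem orientsChords_improper (hT : IsClosedOrientation D T) (hD : IsConsistent D)
    (htot : ∀ x y, Proper D x y → T x y ∨ T y x)
    (hmin : ∀ m < n, 0 < m → ∀ x, ¬ HasWalk T m x x) : OrientsChords T (Improper D) n where
  trans := hD.improper_trans
  not_left Txy h := h.not_proper (hT.proper Txy)
  not_right Txy h := h.not_proper_symm (hT.proper Txy)
  chord := HasWalk.improper_or_improper_of_minimal hD htot hmin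

theorem acyclic (hT : IsClosedOrientation D T) (hD : IsConsistent D)
    (htot : ∀ x y, Proper D x y → T x y ∨ T y x) (x : V) : ¬ TransGen T x x := by
  classical
  intro hx
  have hex : ∃ n, 0 < n ∧ ∃ x, HasWalk T n x x := by
    obtain ⟨n, hn, hw⟩ := HasWalk.exists_of_transGen hx
    exact ⟨n, hn, x, hw⟩
  obtain ⟨hpos, x₀, hw⟩ := Nat.find_spec hex
  have hmin : ∀ m < Nat.find hex, 0 < m → ∀ x, ¬ HasWalk T m x x :=
    fun m hm h0 x hw => Nat.find_min hex hm ⟨h0, x, hw⟩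
  generalize Nat.find hex = n at hpos hw hmin
  match n, hw with
  | 1, ⟨_, h₀₀, rfl⟩ => exact hT.asymm h₀₀ h₀₀
  | 2, ⟨x₁, h₀₁, _, h₁₀, rfl⟩ => exact hT.asymm h₀₁ h₁₀
  | 3, ⟨x₁, h₀₁, x₂, h₁₂, _, h₂₀, rfl⟩ =>
    exact hT.asymm h₂₀ (hT.trans h₀₁ h₁₂ (hT.proper h₂₀).symm)
  | 4, ⟨x₁, h₀₁, x₂, h₁₂, x₃, h₂₃, _, h₃₀, rfl⟩ =>
    have path : ∀ {x y z}, T x y → T y z → HasWalk T 2 x z := fun h h' => ⟨_, h, _, h', rfl⟩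
    have chord : ∀ {x y}, HasWalk T 2 x y → HasWalk T 2 y x → ¬ Proper D x y :=
      HasWalk.not_proper_of_minimal htot hmin le_rfl le_rfl rfl
    exact hT.not_four_cycle hD h₀₁ h₁₂ h₂₃ h₃₀ (chord (path h₀₁ h₁₂) (path h₂₃ h₃₀))
      (chord (path h₁₂ h₂₃) (path h₃₀ h₀₁))
  | n + 5, ⟨x₁, h₀₁, x₂, h₁₂, x₃, h₂₃, x₄, h₃₄, h₄₀⟩ =>
    have hR := hT.orientsChords_improper hD htot hmin
    have w₂₀ : HasWalk T (n + 3) x₂ x₀ := ⟨x₃, h₂₃, x₄, h₃₄, h₄₀⟩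
    rcases hR.chord le_rfl (by omega) (by omega) ⟨x₁, h₀₁, x₂, h₁₂, rfl⟩ w₂₀ with h | h
    · exact hR.not_first_chord h₀₁ h₁₂ h₂₃ h₃₄ h₄₀ h
    · exact hR.symm.not_first_chord h₀₁ h₁₂ h₂₃ h₃₄ h₄₀ h

end IsClosedOrientation

theorem exists_isStrictTotalOrder_of_acyclic {α : Type*} {r : α → α → Prop}
    (h : ∀ x, ¬ TransGen r x x) : ∃ lt : α → α → Prop, IsStrictTotalOrder α lt ∧ r ≤ lt := by
  have : IsStrictOrder α (TransGen r) := { irrefl := h, trans := fun _ _ _ => .trans }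
  let := partialOrderOfSO (TransGen r)
  refine ⟨fun x y => toLinearExtension x < toLinearExtension y,
    inferInstanceAs (IsStrictTotalOrder (LinearExtension α) (· < ·)), fun x y hxy => ?_⟩
  have hlt : x < y := TransGen.single hxy
  exact (toLinearExtension.monotone hlt.le).lt_of_ne hlt.ne

end Acyclicity

/-- The pair `(x, z)` is joined by two arcs, and `{(x, z)}` is an implication class. The algorithm
never treats such a class, although the pair is proper. -/
def TrivialDouble (D : Digraph V) (x z : V) : Prop :=
  Double D x z ∧ ¬ (classOf D x z).Nontrivial

/-- A partial orientation by nontrivial classes that is transitive as far as pairs with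
nontrivial classes are concerned. -/
structure IsSaturated (D : Digraph V) (T : V → V → Prop) : Prop
    extends IsPartialOrientation D T where
  nontrivial : ∀ {x y}, T x y → (classOf D x y).Nontrivial
  trans : ∀ {x y z}, T x y → T y z → (classOf D x z).Nontrivial → T x z

/-- The relation `T` together with the trivial double pairs that it implies by transitivity. -/
def completion (D : Digraph V) (T : V → V → Prop) (x z : V) : Prop :=
  T x z ∨ TrivialDouble D x z ∧ ∃ y, T x y ∧ T y z

section Saturation

variable {T T₁ : V → V → Prop} {w k m : V}

theorem TrivialDouble.symm (h : TrivialDouble D x z) : TrivialDouble D z x :=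
  ⟨h.1.symm, fun hn => h.2 (nontrivial_classOf_symm hn)⟩

theorem TrivialDouble.proper (h : TrivialDouble D x z) : Proper D x z := .inr h.1

theorem TrivialDouble.eq_of_classOf_eq (h : TrivialDouble D x z) (hD : IsConsistent D)
    (e : classOf D x' y' = classOf D x z) : x' = x ∧ y' = z :=
  hD.eq_of_not_nontrivial h.2 (hD.ne_of_adj h.1.1) e

theorem TrivialDouble.classOf_ne (h : TrivialDouble D x z)
    (hn : (classOf D x' y').Nontrivial) : classOf D x' y' ≠ classOf D x z :=
  fun e => h.2 (e ▸ hn)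

theorem IsConsistent.not_nontrivial_of_trivialDouble (hD : IsConsistent D)
    (hxy : TrivialDouble D x y) (hxz : TrivialDouble D x z) : ¬ (classOf D y z).Nontrivial := by
  intro hyz
  obtain ⟨⟨y', z'⟩, h, hne⟩ := hyz.exists_ne (y, z)
  obtain ⟨hy, hz⟩ := hD.triangle hxy.proper hxz.proper (hxz.classOf_ne hyz)
    (hxy.symm.classOf_ne hyz) (hD.ne_of_nontrivial hyz) (classOf_eq_of_mem h)
  exact hne (Prod.ext (hxy.eq_of_classOf_eq hD hy).2 (hxz.eq_of_classOf_eq hD hz).2)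

namespace IsSaturated

theorem swap (hT : IsSaturated D T) : IsSaturated D (Function.swap T) where
  toIsPartialOrientation := hT.toIsPartialOrientation.swap
  nontrivial h := nontrivial_classOf_symm (hT.nontrivial h)
  trans hxy hyz hn := hT.trans hyz hxy (nontrivial_classOf_symm hn)

theorem snd_eq_of_classOf_eq (hT : IsSaturated D T) (hD : IsConsistent D) (hxy : T x y)
    (hyz : T y z) (hxz : TrivialDouble D x z) (h : classOf D x' y' = classOf D y z) : y' = z :=
  (hxz.eq_of_classOf_eq hD (hD.triangle (hT.proper hxy) hxz.proper
    (hxz.classOf_ne (hT.nontrivial hyz)) (hT.classOf_ne_left hxy hyz).symm (hT.ne hD hyz) h).2).2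

theorem fst_eq_of_classOf_eq (hT : IsSaturated D T) (hD : IsConsistent D) (hxy : T x y)
    (hyz : T y z) (hxz : TrivialDouble D x z) (h : classOf D x' y' = classOf D x y) : x' = x :=
  hT.swap.snd_eq_of_classOf_eq hD hyz hxy hxz.symm (classOf_swap_eq h)

theorem classOf_eq_or_trivialDouble (hT : IsSaturated D T) (hD : IsConsistent D) (hxy : T x y)
    (hyz : T y z) (hxz : ¬ T x z) : classOf D x y = classOf D y z ∨ TrivialDouble D x z := by
  have not_nontrivial : ¬ (classOf D x z).Nontrivial := fun hn => hxz (hT.trans hxy hyz hn)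
  by_cases hd : Double D x z
  · exact .inr ⟨hd, not_nontrivial⟩
  · exact .inl <| hT.classOf_eq_of_not_proper hD hxy hyz fun h => h.elim not_nontrivial hd

theorem completion_of_proper (hT : IsSaturated D T) (hxy : T x y) (hyz : T y z)
    (pxz : Proper D x z) : completion D T x z := by
  by_cases hn : (classOf D x z).Nontrivial
  · exact .inl (hT.trans hxy hyz hn)
  · exact .inr ⟨⟨pxz.resolve_left hn, hn⟩, y, hxy, hyz⟩

theorem trans_of_trivialDouble (hT : IsSaturated D T) (hD : IsConsistent D) (hxy : T x y)
    (hyz : T y z) (hzw : T z w) (hxz : TrivialDouble D x z) : T y w := by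
  by_contra hyw
  rcases hT.classOf_eq_or_trivialDouble hD hyz hzw hyw with h | hyw
  · exact hT.ne hD hzw (hT.snd_eq_of_classOf_eq hD hxy hyz hxz h.symm).symm
  · obtain ⟨⟨y', z'⟩, h, hne⟩ := (hT.nontrivial hyz).exists_ne (y, z)
    have h := classOf_eq_of_mem h
    exact hne (Prod.ext (hT.fst_eq_of_classOf_eq hD hyz hzw hyw h)
      (hT.snd_eq_of_classOf_eq hD hxy hyz hxz h))

theorem trans_of_trivialDouble_of_trivialDouble (hT : IsSaturated D T) (hD : IsConsistent D)
    (hxm : T x m) (hmy : T m y) (hyk : T y k) (hkz : T k z) (hxy : TrivialDouble D x y)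
    (hyz : TrivialDouble D y z) : T m z := by
  by_contra hmz
  have hmk := hT.trans_of_trivialDouble hD hxm hmy hyk hxy
  rcases hT.classOf_eq_or_trivialDouble hD hmk hkz hmz with h | hmz
  · exact hT.ne hD hkz (hT.snd_eq_of_classOf_eq hD hyk hkz hyz h)
  · exact hD.not_nontrivial_of_trivialDouble hmz.symm hyz.symm (hT.nontrivial hmy)

theorem isClosedOrientation_completion (hT : IsSaturated D T) (hD : IsConsistent D)
    (hT₁ : IsClosedOrientation D T₁) (hle : T ≤ T₁) : IsClosedOrientation D (completion D T) := by
  have completion_le : completion D T ≤ T₁ := by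
    rintro x z (hxz | ⟨hxz, y, hxy, hyz⟩)
    · exact hle x z hxz
    · exact hT₁.trans (hle x y hxy) (hle y z hyz) hxz.proper
  refine ⟨⟨fun h => hT₁.proper (completion_le _ _ h), ?_,
    fun h h' => hT₁.asymm (completion_le _ _ h) (completion_le _ _ h')⟩, ?_⟩
  · rintro x y x' y' (hxy | hxy) e
    · exact .inl (hT.congr hxy e)
    · obtain ⟨rfl, rfl⟩ := hxy.1.eq_of_classOf_eq hD e
      exact .inr hxy
  · rintro x y z (hxy | ⟨hxy, m, hxm, hmy⟩) (hyz | ⟨hyz, k, hyk, hkz⟩) pxz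
    · exact hT.completion_of_proper hxy hyz pxz
    · have hxk : T x k := hT.swap.trans_of_trivialDouble hD hkz hyk hxy hyz.symm
      exact hT.completion_of_proper hxk hkz pxz
    · exact hT.completion_of_proper hxm (hT.trans_of_trivialDouble hD hxm hmy hyz hxy) pxz
    · exact hT.completion_of_proper hxm
        (hT.trans_of_trivialDouble_of_trivialDouble hD hxm hmy hyk hkz hxy hyz) pxz

end IsSaturated

end Saturation

section Orderings

variable {T lt : V → V → Prop}

theorem isComparabilityOrdering_of_congr (hlt : IsStrictTotalOrder V lt)
    (h : ∀ {x y x' y'}, lt x y → classOf D x' y' = classOf D x y → lt x' y') :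
    IsComparabilityOrdering D lt := by
  have classOf_ne : ∀ {x y z}, lt x y → lt y z → classOf D y x ≠ classOf D y z :=
    fun hxy hyz e => hlt.irrefl _ (hlt.trans _ _ _ hxy (h hyz e))
  refine ⟨hlt, fun x y z hxy hyz axy ayz => ?_, fun x y z hxy hyz azy ayx => ?_⟩
  · by_contra axz
    exact classOf_ne hxy hyz (classOf_eq_of_path axy ayz axz)
  · by_contra azx
    exact classOf_ne hxy hyz (classOf_eq_of_path azy ayx azx).symm

theorem isComparabilityOrdering_of_le (hD : IsSemicomplete D) (hlt : IsStrictTotalOrder V lt)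
    (hT : ∀ {x y x' y'}, T x y → classOf D x' y' = classOf D x y → T x' y') (hle : T ≤ lt)
    (htot : ∀ x y, (classOf D x y).Nontrivial → T x y ∨ T y x) :
    IsComparabilityOrdering D lt := by
  refine isComparabilityOrdering_of_congr hlt fun {x y x' y'} hxy e => ?_
  have hne : x ≠ y := by
    rintro rfl
    exact hlt.irrefl _ hxy
  by_cases hn : (classOf D x y).Nontrivial
  · rcases htot x y hn with h | h
    · exact hle _ _ (hT h e)
    · exact (hlt.irrefl _ (hlt.trans _ _ _ hxy (hle _ _ h))).elim
  · obtain ⟨rfl, rfl⟩ := hD.eq_of_not_nontrivial hn hne e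
    exact hxy

theorem IsClosedOrientation.exists_isStrictTotalOrder (hT : IsClosedOrientation D T)
    (hD : IsConsistent D) :
    ∃ lt, IsStrictTotalOrder V lt ∧ T ≤ lt ∧ IsComparabilityOrdering D lt := by
  obtain ⟨T', hT', hTT', htot⟩ := hT.exists_total hD
  obtain ⟨lt, hlt, hle⟩ := exists_isStrictTotalOrder_of_acyclic (hT'.acyclic hD htot)
  exact ⟨lt, hlt, hTT'.trans hle, isComparabilityOrdering_of_le hD.toIsSemicomplete hlt hT'.congr
    hle fun x y hn => htot x y (.inl hn)⟩

end Orderings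

theorem isConsistent_of_ne_inverse (hD : IsSemicomplete D)
    (hI : ∀ I ∈ implicationClasses D, I ≠ inverse I) : IsConsistent D where
  toIsSemicomplete := hD
  classOf_ne x y h := by
    rw [classOf_swap x y]
    exact hI _ ⟨(x, y), hD.total x y h, rfl⟩

theorem isClosedOrientation_bot : IsClosedOrientation D ⊥ where
  proper h := h.elim
  congr h _ := h
  asymm h := h.elim
  trans h _ _ := h

/-- The invariant of the while loop: `T` is a union of nontrivial implication classes that extends
to a closed orientation, and `C` consists of the nontrivial classes undecided by `T`. -/
structure LoopInvariant (D : Digraph V) (T : Set (V × V)) (C : Set (Set (V × V))) : Prop where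
  nontrivial : ∀ {x y}, (x, y) ∈ T → (classOf D x y).Nontrivial
  congr : ∀ {x y x' y'}, (x, y) ∈ T → classOf D x' y' = classOf D x y → (x', y') ∈ T
  exists_closed : ∃ T₁, IsClosedOrientation D T₁ ∧ ∀ x y, (x, y) ∈ T → T₁ x y
  mem_iff : ∀ {I}, I ∈ C ↔
    ∃ x y, I = classOf D x y ∧ (classOf D x y).Nontrivial ∧ (x, y) ∉ T ∧ (y, x) ∉ T

section Algorithm

variable {T : Set (V × V)} {C : Set (Set (V × V))} {I : Set (V × V)} {u v : V}

theorem mem_classOf_iff (hxy : (x, y) ∈ pairs D) :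
    (x, y) ∈ classOf D u v ↔ classOf D x y = classOf D u v :=
  ⟨classOf_eq_of_mem, fun h => h ▸ mem_classOf_self hxy⟩

namespace LoopInvariant

theorem init (hD : IsSemicomplete D) :
    LoopInvariant D ∅ {I | I ∈ implicationClasses D ∧ I.Nontrivial} where
  nontrivial h := h.elim
  congr h _ := h.elim
  exists_closed := ⟨⊥, isClosedOrientation_bot, fun _ _ h => h⟩
  mem_iff {I} := by
    constructor
    · rintro ⟨⟨⟨x, y⟩, -, rfl⟩, hn⟩
      exact ⟨x, y, rfl, hn, id, id⟩
    · rintro ⟨x, y, rfl, hn, -, -⟩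
      exact ⟨⟨(x, y), hD.mem_pairs.2 (hD.ne_of_nontrivial hn), rfl⟩, hn⟩

theorem asymm (h : LoopInvariant D T C) (hxy : (x, y) ∈ T) : (y, x) ∉ T := by
  obtain ⟨T₁, hT₁, hle⟩ := h.exists_closed
  exact fun hyx => hT₁.asymm (hle _ _ hxy) (hle _ _ hyx)

theorem isPartialOrientation (h : LoopInvariant D T C) :
    IsPartialOrientation D (fun x y => (x, y) ∈ T) where
  proper hxy := .inl (h.nontrivial hxy)
  congr := h.congr
  asymm := h.asymm

theorem union_classOf (h : LoopInvariant D T C) (hD : IsSemicomplete D)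
    (huv : (classOf D u v).Nontrivial)
    (hT₁ : ∃ T₁, IsClosedOrientation D T₁ ∧ (∀ x y, (x, y) ∈ T → T₁ x y) ∧ T₁ u v) :
    LoopInvariant D (T ∪ classOf D u v) (C \ {classOf D u v, inverse (classOf D u v)}) where
  nontrivial hxy := hxy.elim h.nontrivial fun hxy => classOf_eq_of_mem hxy ▸ huv
  congr hxy e := hxy.imp (fun hxy => h.congr hxy e) fun hxy =>
    mem_classOf_of_eq (e.trans (classOf_eq_of_mem hxy)) (hD.mem_pairs.2 (hD.ne_of_nontrivial huv))
  exists_closed := by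
    obtain ⟨T₁, hT₁, hle, huv₁⟩ := hT₁
    exact ⟨T₁, hT₁, fun x y hxy => hxy.elim (hle x y) fun hxy =>
      hT₁.congr huv₁ (classOf_eq_of_mem hxy)⟩
  mem_iff {I} := by
    have mem_iff_eq : ∀ {x y}, (classOf D x y).Nontrivial →
        ((x, y) ∈ classOf D u v ↔ classOf D x y = classOf D u v) ∧
        ((y, x) ∈ classOf D u v ↔ classOf D x y = inverse (classOf D u v)) := by
      intro x y hn
      have hxy := hD.ne_of_nontrivial hn
      rw [mem_classOf_iff (hD.mem_pairs.2 hxy), mem_classOf_iff (hD.mem_pairs.2 hxy.symm),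
        ← classOf_swap u v]
      exact ⟨.rfl, classOf_swap_eq, classOf_swap_eq⟩
    constructor
    · rintro ⟨hI, hne⟩
      obtain ⟨x, y, rfl, hn, hxy, hyx⟩ := h.mem_iff.1 hI
      rw [Set.mem_insert_iff, Set.mem_singleton_iff, ← (mem_iff_eq hn).1, ← (mem_iff_eq hn).2,
        not_or] at hne
      exact ⟨x, y, rfl, hn, not_or.2 ⟨hxy, hne.1⟩, not_or.2 ⟨hyx, hne.2⟩⟩
    · rintro ⟨x, y, rfl, hn, hxy, hyx⟩
      obtain ⟨hxy, hxy'⟩ := not_or.1 hxy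
      obtain ⟨hyx, hyx'⟩ := not_or.1 hyx
      refine ⟨h.mem_iff.2 ⟨x, y, rfl, hn, hxy, hyx⟩, ?_⟩
      rw [Set.mem_insert_iff, Set.mem_singleton_iff, ← (mem_iff_eq hn).1, ← (mem_iff_eq hn).2]
      exact not_or.2 ⟨hxy', hyx'⟩

theorem forced (h : LoopInvariant D T C) (hD : IsSemicomplete D) (hI : I ∈ C)
    (hf : ForcedBy T I) : LoopInvariant D (T ∪ I) (C \ {I, inverse I}) := by
  obtain ⟨u, v, rfl, hn, -, -⟩ := h.mem_iff.1 hI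
  obtain ⟨T₁, hT₁, hle⟩ := h.exists_closed
  obtain ⟨x, y, z, hxy, hyz, hxz⟩ := hf
  have hxz_uv := classOf_eq_of_mem hxz
  have T₁xz : T₁ x z := hT₁.trans (hle x y hxy) (hle y z hyz) (.inl (hxz_uv ▸ hn))
  exact h.union_classOf hD hn ⟨T₁, hT₁, hle, hT₁.congr T₁xz hxz_uv.symm⟩

theorem isSaturated (h : LoopInvariant D T C) (hD : IsSemicomplete D)
    (hf : ¬ ∃ J ∈ C, ForcedBy T J) : IsSaturated D (fun x y => (x, y) ∈ T) where
  toIsPartialOrientation := h.isPartialOrientation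
  nontrivial := h.nontrivial
  trans {x y z} hxy hyz hn := by
    by_contra hxz
    by_cases hzx : (z, x) ∈ T
    · obtain ⟨T₁, hT₁, hle⟩ := h.exists_closed
      exact hT₁.asymm (hle _ _ hzx) (hT₁.trans (hle _ _ hxy) (hle _ _ hyz) (.inl hn))
    · have hself := mem_classOf_self (hD.mem_pairs.2 (hD.ne_of_nontrivial hn))
      exact hf ⟨_, h.mem_iff.2 ⟨x, z, rfl, hn, hxz, hzx⟩, x, y, z, hxy, hyz, hself⟩

theorem free (h : LoopInvariant D T C) (hD : IsConsistent D) (hI : I ∈ C)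
    (hf : ¬ ∃ J ∈ C, ForcedBy T J) : LoopInvariant D (T ∪ I) (C \ {I, inverse I}) := by
  obtain ⟨u, v, rfl, hn, -, hvu⟩ := h.mem_iff.1 hI
  obtain ⟨T₁, hT₁, hle⟩ := h.exists_closed
  have hT₀ := (h.isSaturated hD.toIsSemicomplete hf).isClosedOrientation_completion hD hT₁ hle
  have not_vu : ¬ completion D (fun x y => (x, y) ∈ T) v u :=
    not_or.2 ⟨hvu, fun h => h.1.2 (nontrivial_classOf_symm hn)⟩
  obtain ⟨T₂, hT₂, hle₂, huv⟩ := hT₀.exists_extension hD (.inl hn) not_vu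
  exact h.union_classOf hD.toIsSemicomplete hn
    ⟨T₂, hT₂, fun x y hxy => hle₂ x y (.inl hxy), huv⟩

theorem isComparabilityOrdering (h : LoopInvariant D T ∅) (hD : IsSemicomplete D)
    {lt : V → V → Prop} (hlt : IsStrictTotalOrder V lt) (hle : ∀ x y, (x, y) ∈ T → lt x y) :
    IsComparabilityOrdering D lt := by
  refine isComparabilityOrdering_of_le hD hlt h.congr hle fun x y hn => ?_
  by_contra hxy
  obtain ⟨hxy, hyx⟩ := not_or.1 hxy
  exact h.mem_iff.2 ⟨x, y, rfl, hn, hxy, hyx⟩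

end LoopInvariant

/-- What holds in every reachable state of the algorithm on input `D`. -/
def StateInvariant (D : Digraph V) : State V → Prop
  | .start => True
  | .loop T C => LoopInvariant D T C
  | .rejected => False
  | .returned lt => IsComparabilityOrdering D lt

variable {s s' : State V}

theorem Step.stateInvariant (h : Step D s s') (hD : IsSemicomplete D)
    (hI : ∀ I ∈ implicationClasses D, I ≠ inverse I) (hs : StateInvariant D s) :
    StateInvariant D s' := by
  cases h with
  | reject h =>
    obtain ⟨I, hI', he⟩ := h
    exact hI I hI' he
  | init => exact .init hD
  | forced T C I hI' h => exact LoopInvariant.forced hs hD hI' h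
  | free T C I hI' h => exact LoopInvariant.free hs (isConsistent_of_ne_inverse hD hI) hI' h
  | finish T lt hlt h => exact LoopInvariant.isComparabilityOrdering hs hD hlt h

theorem stateInvariant_of_reachable (hD : IsSemicomplete D)
    (hI : ∀ I ∈ implicationClasses D, I ≠ inverse I) (hs : ReflTransGen (Step D) .start s) :
    StateInvariant D s := by
  induction hs with
  | refl => trivial
  | tail _ h ih => exact h.stateInvariant hD hI ih

theorem StateInvariant.exists_step_or_returned (hs : StateInvariant D s) (hD : IsSemicomplete D)
    (hI : ∀ I ∈ implicationClasses D, I ≠ inverse I) :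
    (∃ s', Step D s s') ∨ ∃ lt, s = .returned lt ∧ IsComparabilityOrdering D lt := by
  match s with
  | .start => exact .inl ⟨_, .init fun ⟨I, hI', he⟩ => hI I hI' he⟩
  | .rejected => exact hs.elim
  | .returned lt => exact .inr ⟨lt, rfl, hs⟩
  | .loop T C =>
    refine .inl ?_
    rcases C.eq_empty_or_nonempty with rfl | ⟨I, hIC⟩
    · obtain ⟨T₁, hT₁, hle⟩ := LoopInvariant.exists_closed hs
      obtain ⟨lt, hlt, hle', -⟩ :=
        hT₁.exists_isStrictTotalOrder (isConsistent_of_ne_inverse hD hI)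
      exact ⟨_, .finish T lt hlt fun x y hxy => hle' x y (hle x y hxy)⟩
    · by_cases hf : ∃ J ∈ C, ForcedBy T J
      · obtain ⟨J, hJ, hf⟩ := hf
        exact ⟨_, .forced T C J hJ hf⟩
      · exact ⟨_, .free T C I hIC hf⟩

theorem acc_step_loop (hC : C.Finite) : Acc (fun s' s => Step D s s') (.loop T C) := by
  induction hn : C.ncard using Nat.strong_induction_on generalizing T C with
  | _ n ih =>
    have remove : ∀ {T I}, I ∈ C →
        Acc (fun s' s => Step D s s') (.loop T (C \ {I, inverse I})) := by
      intro T I hI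
      have hlt : (C \ {I, inverse I}).ncard < C.ncard :=
        Set.ncard_lt_ncard ⟨Set.sdiff_subset, fun h => (h hI).2 (.inl rfl)⟩ hC
      exact ih _ (hn ▸ hlt) hC.sdiff rfl
    refine ⟨_, fun s' h => ?_⟩
    cases h with
    | forced _ _ I hI => exact remove hI
    | free _ _ I hI => exact remove hI
    | finish _ lt => exact ⟨_, fun s'' h => nomatch h⟩

theorem acc_step_start (hfin : {I | I ∈ implicationClasses D ∧ I.Nontrivial}.Finite) :
    Acc (fun s' s => Step D s s') .start := by
  refine ⟨_, fun s' h => ?_⟩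
  cases h with
  | reject => exact ⟨_, fun s'' h => nomatch h⟩
  | init => exact acc_step_loop hfin

theorem not_exists_run (hfin : {I | I ∈ implicationClasses D ∧ I.Nontrivial}.Finite) :
    ¬ ∃ run : ℕ → State V, run 0 = .start ∧ ∀ n, Step D (run n) (run (n + 1)) := by
  rintro ⟨run, h0, hrun⟩
  exact (acc_iff_isEmpty_descending_chain.1 (acc_step_start hfin)).false ⟨run, h0, hrun⟩

end Algorithm

end ComparabilityDigraph

open ComparabilityDigraph in
theorem mainTheorem4_general {V : Type*} (D : Digraph V) (hD : IsSemicomplete D)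
    (hI : ∀ I ∈ implicationClasses D, I ≠ inverse I) :
    ({I | I ∈ implicationClasses D ∧ I.Nontrivial}.Finite →
      ¬ ∃ run : ℕ → State V, run 0 = .start ∧ ∀ n, Step D (run n) (run (n + 1))) ∧
    (∀ s : State V, Relation.ReflTransGen (Step D) .start s → (¬ ∃ s', Step D s s') →
      ∃ lt : V → V → Prop, s = .returned lt ∧ IsComparabilityOrdering D lt) ∧
    IsComparabilityDigraph D := by
  refine ⟨not_exists_run, fun s hs hstep => ?_, ?_⟩
  · have hinv := stateInvariant_of_reachable hD hI hs
    exact (hinv.exists_step_or_returned hD hI).resolve_left hstep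
  · obtain ⟨lt, -, -, hlt⟩ :=
      isClosedOrientation_bot.exists_isStrictTotalOrder (isConsistent_of_ne_inverse hD hI)
    exact ⟨lt, hlt⟩

/-- On a finite semicomplete digraph without an implication class that equals its
inverse: no run of the algorithm is infinite; every run that cannot be continued has
returned a comparability ordering (so no run rejects or gets stuck, whatever choices
are made); and the digraph is a comparability digraph. -/
theorem mainTheorem4 {V : Type*} [Finite V] (D : Digraph V)
    (hD : ComparabilityDigraph.IsSemicomplete D)
    (hI : ∀ I ∈ ComparabilityDigraph.implicationClasses D,
      I ≠ ComparabilityDigraph.inverse I) :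
    (¬ ∃ run : ℕ → ComparabilityDigraph.State V,
        run 0 = .start ∧ ∀ n, ComparabilityDigraph.Step D (run n) (run (n + 1))) ∧
    (∀ s : ComparabilityDigraph.State V,
        Relation.ReflTransGen (ComparabilityDigraph.Step D) .start s →
        (¬ ∃ s', ComparabilityDigraph.Step D s s') →
        ∃ lt : V → V → Prop, s = .returned lt ∧
          ComparabilityDigraph.IsComparabilityOrdering D lt) ∧
    ComparabilityDigraph.IsComparabilityDigraph D := by
  obtain ⟨terminates, rest⟩ := mainTheorem4_general D hD hI
  exact ⟨terminates (Set.toFinite _), rest⟩
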